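/- Let $K$ be a field and let $G$ be a finite simple graph with vertex set $V$ and edge set $E$. Consider the polynomial rings $K[q]=K[q_{A|B}]$, with one variable for each unordered partition $A|B$ of $V$ (that is, $A\cap B=\emptyset$, $A\cup B=V$, empty parts allowed), and $K[s,t_{ij} \mid ij\in E]$. The cut ideal $I_G$ is the kernel of the $K$-algebra homomorphism $$\pi_G: K[q]\to K[s,t_{ij} \mid ij\in E],\qquad q_{A|B}\mapsto s\cdot\prod_{ij\in E,\ |A\cap\{i,j\}|=1} t_{ij}.$$ Assume that neither the complete graph $K_4$ nor the cycle $C_5$ of length five is a minor of $G$ (a graph $H$ is a minor of $G$ if it is obtained from $G$ by deleting edges and vertices and contracting edges). Then there is a monomial order on $K[q]$ with respect to which $I_G$ has a finite Gröbner basis consisting of homogeneous polynomials of degree at most $2$. If $G$ is connected, there is such a monomial order and Gröbner basis in which all elements are homogeneous of degree exactly $2$ (the empty set being allowed when $I_G=0$); that is, $I_G$ has a quadratic Gröbner basis. -/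

import Mathlib

universe u v w

namespace CutIdeal

/-- `H` is a minor of `G`: there are pairwise disjoint connected (in particular non-empty)
branch sets in `G`, one for each vertex of `H`, such that adjacent vertices of `H` have
branch sets joined by an edge of `G`. -/
def HasMinor {V : Type u} {W : Type w} (G : SimpleGraph V) (H : SimpleGraph W) : Prop :=
  ∃ B : W → Set V,
    (∀ x, (G.induce (B x)).Connected) ∧
    (∀ x y, x ≠ y → Disjoint (B x) (B y)) ∧
    ∀ x y, H.Adj x y → ∃ a ∈ B x, ∃ b ∈ B y, G.Adj a b

/-- Two sets span the same unordered partition `A | B` of `V`, `B = Aᶜ`, when they are equal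
or complementary. -/
def cutSetoid (V : Type u) : Setoid (Set V) where
  r A A' := A' = A ∨ A' = Aᶜ
  iseqv :=
    { refl := fun _ => Or.inl rfl
      symm := by
        rintro A A' (rfl | rfl)
        · exact Or.inl rfl
        · exact Or.inr (compl_compl A).symm
      trans := by
        rintro A A' A'' (rfl | rfl) (rfl | rfl)
        · exact Or.inl rfl
        · exact Or.inr rfl
        · exact Or.inr rfl
        · exact Or.inl (compl_compl A) }

/-- The unordered partitions `A | B` of `V` into two (possibly empty) parts. -/
def Cut (V : Type u) : Type u := Quotient (cutSetoid V)

/-- The partition `A | Aᶜ`. -/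
def Cut.mk {V : Type u} (A : Set V) : Cut V := Quotient.mk (cutSetoid V) A

/-- The pair `e = ij` is separated by `A | B`, that is, `|A ∩ {i, j}| = 1`. -/
def Cut.Separates {V : Type u} (c : Cut V) (e : Sym2 V) : Prop :=
  Quotient.lift (s := cutSetoid V) (fun A : Set V => ∃ i ∈ A, ∃ j ∉ A, e = s(i, j))
    (by
      have key : ∀ A : Set V, (∃ i ∈ A, ∃ j ∉ A, e = s(i, j)) →
          ∃ i ∈ Aᶜ, ∃ j ∉ Aᶜ, e = s(i, j) := by
        rintro A ⟨i, hi, j, hj, rfl⟩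
        exact ⟨j, hj, i, fun h => h hi, Sym2.eq_swap⟩
      rintro A A' (rfl | rfl)
      · rfl
      · exact propext ⟨key A, fun h => by simpa only [compl_compl] using key Aᶜ h⟩) c

open scoped Classical in
/-- The homomorphism `K[q] → K[s, T]`, `q_{A|B} ↦ s · ∏ t_{ij}`, the product over the edges
`ij` of `G` separated by `A | B`. The variable `s` has index `none` and `t_e` has index
`some e`. -/
noncomputable def cutHom (K : Type v) [Field K] {V : Type u} [Fintype V] (G : SimpleGraph V) :
    MvPolynomial (Cut V) K →ₐ[K] MvPolynomial (Option G.edgeSet) K :=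
  MvPolynomial.aeval fun c =>
    MvPolynomial.X none *
      ∏ e : G.edgeSet, if c.Separates (e : Sym2 V) then MvPolynomial.X (some e) else 1

/-- The cut ideal `I_G`. -/
noncomputable def cutIdeal (K : Type v) [Field K] {V : Type u} [Fintype V]
    (G : SimpleGraph V) : Ideal (MvPolynomial (Cut V) K) :=
  RingHom.ker (cutHom K G)

/-- The ideal generated by the initial monomials of the non-zero elements of `S`. -/
noncomputable def initialIdeal {K : Type v} [Field K] {σ : Type u} (m : MonomialOrder.{u, u} σ)
    (S : Set (MvPolynomial σ K)) : Ideal (MvPolynomial σ K) :=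
  Ideal.span {p | ∃ f ∈ S, f ≠ 0 ∧ p = MvPolynomial.monomial (m.degree f) 1}

/-- The finite set `S` of non-zero elements of `I` is a Gröbner basis of `I` with respect to
the monomial order `m`: the initial monomials of `S` generate the initial ideal of `I`. -/
def IsGroebnerBasis {K : Type v} [Field K] {σ : Type u} (m : MonomialOrder.{u, u} σ)
    (I : Ideal (MvPolynomial σ K)) (S : Finset (MvPolynomial σ K)) : Prop :=
  (∀ g ∈ S, g ∈ I ∧ g ≠ 0) ∧
    initialIdeal m (S : Set (MvPolynomial σ K)) = initialIdeal m (I : Set (MvPolynomial σ K))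

end CutIdeal

namespace CutIdeal

/-! Binomials of the kernel form a Gröbner basis as soon as each fibre of the exponent map contains
at most one monomial that they do not reduce; `isGroebnerBasis_cutBinomials` applies this to the
binomials of degree one and two. It remains to find a weight on cuts for which a monomial that is
minimal two factors at a time is determined by its image. `QuadraticallyDetermined` expresses this
for the 0/1 vectors of the cuts.

The property passes to Minkowski sums (`QuadraticallyDetermined.add`), hence to graphs glued along
at most one vertex (`QuadraticallyDetermined.of_separation`). It is proved directly for theta
graphs: two poles, common neighbours of the poles, and possibly the edge joining the poles
(`quadraticallyDetermined_theta`). In both proofs the weight forces elements into chains, and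
`eq_of_chain` recovers a chain from its coordinates.

The graph theory shows that `G` is glued from such pieces. For well-chosen poles, a path leaving the
theta subgraph and returning at another vertex would close a cycle of length at least five or
contradict the choice. So every component outside meets the theta subgraph in at most one vertex,
and induction on `G` applies (`QuadraticallyDetermined.of_no_ear`). The absence of a `K₄` minor only
serves to exclude edges between common neighbours of adjacent poles. -/

/-! ### Chains, pairwise minimality and Minkowski sums -/

theorem exists_least_of_total {α : Type*} (r : α → α → Prop) (hr : ∀ x y z, r x y → r y z → r x z)
    (s : Multiset α) (hs0 : s ≠ 0) (hs : ∀ x ∈ s, ∀ y ∈ s, r x y ∨ r y x) :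
    ∃ x ∈ s, ∀ y ∈ s, r x y := by
  induction s using Multiset.induction_on with
  | empty => exact absurd rfl hs0
  | cons a s ih =>
    have haa : r a a := by simpa using hs a (Multiset.mem_cons_self a s) a (Multiset.mem_cons_self a s)
    by_cases h0 : s = 0
    · subst h0
      exact ⟨a, by simp, by simpa using haa⟩
    · obtain ⟨x, hx, hmin⟩ := ih h0 fun x hx y hy =>
        hs x (Multiset.mem_cons_of_mem hx) y (Multiset.mem_cons_of_mem hy)
      rcases hs a (Multiset.mem_cons_self a s) x (Multiset.mem_cons_of_mem hx) with h | h
      · refine ⟨a, Multiset.mem_cons_self a s, fun y hy => ?_⟩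
        rcases Multiset.mem_cons.1 hy with rfl | hy
        · exact haa
        · exact hr _ _ _ h (hmin y hy)
      · refine ⟨x, Multiset.mem_cons_of_mem hx, fun y hy => ?_⟩
        rcases Multiset.mem_cons.1 hy with rfl | hy
        · exact h
        · exact hmin y hy

/-- A multiset which is a chain for a family of coordinates is determined by the multisets of
its coordinates. -/
theorem eq_of_chain {ι α : Type*} (f : ι → α → ℕ) (s t : Multiset α)
    (hs : ∀ x ∈ s, ∀ y ∈ s, (∀ i, f i x ≤ f i y) ∨ ∀ i, f i y ≤ f i x)
    (ht : ∀ x ∈ t, ∀ y ∈ t, (∀ i, f i x ≤ f i y) ∨ ∀ i, f i y ≤ f i x)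
    (hinj : ∀ x ∈ s, ∀ y ∈ t, (∀ i, f i x = f i y) → x = y)
    (hcard : s.card = t.card) (h : ∀ i, s.map (f i) = t.map (f i)) : s = t := by
  induction hn : s.card generalizing s t with
  | zero =>
    rw [Multiset.card_eq_zero.1 hn, Multiset.card_eq_zero.1 (hcard.symm.trans hn)]
  | succ n ih =>
    obtain ⟨x, hx, hxmin⟩ := exists_least_of_total (fun x y => ∀ i, f i x ≤ f i y)
      (fun _ _ _ h h' i => (h i).trans (h' i)) s (Multiset.card_pos.1 (by omega)) hs
    obtain ⟨y, hy, hymin⟩ := exists_least_of_total (fun x y => ∀ i, f i x ≤ f i y)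
      (fun _ _ _ h h' i => (h i).trans (h' i)) t (Multiset.card_pos.1 (by omega)) ht
    -- The least element of a chain realises the minimum of every coordinate, and these minima are
    -- the same for `s` and `t`.
    have hxy : x = y := by
      refine hinj x hx y hy fun i => le_antisymm ?_ ?_
      · obtain ⟨z, hz, hzi⟩ := Multiset.mem_map.1 ((h i).symm ▸ Multiset.mem_map_of_mem (f i) hy)
        exact hzi ▸ hxmin z hz i
      · obtain ⟨z, hz, hzi⟩ := Multiset.mem_map.1 ((h i) ▸ Multiset.mem_map_of_mem (f i) hx)
        exact hzi ▸ hymin z hz i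
    subst hxy
    obtain ⟨s, rfl⟩ := Multiset.exists_cons_of_mem hx
    obtain ⟨t, rfl⟩ := Multiset.exists_cons_of_mem hy
    congr 1
    refine ih s t (fun x hx y hy => hs x (Multiset.mem_cons_of_mem hx) y
      (Multiset.mem_cons_of_mem hy)) (fun x hx y hy => ht x (Multiset.mem_cons_of_mem hx) y
      (Multiset.mem_cons_of_mem hy)) (fun x hx y hy => hinj x (Multiset.mem_cons_of_mem hx) y
      (Multiset.mem_cons_of_mem hy)) (by simpa using hcard) (fun i => ?_) (by simpa using hn)
    simpa using h i

/-- A multiset of elements of `D` is pairwise minimal for the weight `w` if no pair of its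
elements can be replaced by a lighter pair of elements of `D` with the same sum. -/
def PairMinimal {M : Type*} [Add M] (D : Set M) (w : M → ℕ) (s : Multiset M) : Prop :=
  (∀ x ∈ s, x ∈ D) ∧ ∀ x ∈ s, ∀ y ∈ s, ∀ x' ∈ D, ∀ y' ∈ D,
    x + y = x' + y' → w x + w y ≤ w x' + w y'

/-- For a suitable weight, a pairwise minimal multiset of elements of `D` is determined by its
cardinality and its sum. -/
def QuadraticallyDetermined {M : Type*} [AddCommMonoid M] (D : Set M) : Prop :=
  ∃ w : M → ℕ, ∀ s t : Multiset M, PairMinimal D w s → PairMinimal D w t →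
    s.card = t.card → s.sum = t.sum → s = t

open scoped Pointwise in
-- The weights of the summands dominate, so both projections of a pairwise minimal multiset are
-- pairwise minimal and hence determined. What remains is how first and second components are
-- matched; a quadratic tie-break forces the matching that is monotone in arbitrary rankings `r₁`,
-- `r₂`.
theorem QuadraticallyDetermined.add {M : Type*} [AddCommMonoid M] {D₁ D₂ : Set M}
    (hD₁ : D₁.Finite) (hD₂ : D₂.Finite) (p₁ p₂ : M →+ M)
    (hp₁ : ∀ x ∈ D₁, ∀ y ∈ D₂, p₁ (x + y) = x) (hp₂ : ∀ x ∈ D₁, ∀ y ∈ D₂, p₂ (x + y) = y)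
    (h₁ : QuadraticallyDetermined D₁) (h₂ : QuadraticallyDetermined D₂) :
    QuadraticallyDetermined (D₁ + D₂) := by
  obtain ⟨w₁, h₁⟩ := h₁
  obtain ⟨w₂, h₂⟩ := h₂
  obtain ⟨r₁, hr₁⟩ := Set.countable_iff_exists_injOn.1 hD₁.countable
  obtain ⟨r₂, hr₂⟩ := Set.countable_iff_exists_injOn.1 hD₂.countable
  -- Exchanging the second components of `m` and `n` changes the total `τ` by twice the product of
  -- their two rank differences, so at a minimum this product is nonnegative.
  let τ : M → ℕ := fun m => (((r₁ (p₁ m) : ℤ) - r₂ (p₂ m)) ^ 2).toNat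
  have hτ : ∀ m, (τ m : ℤ) = ((r₁ (p₁ m) : ℤ) - r₂ (p₂ m)) ^ 2 := fun m =>
    Int.toNat_of_nonneg (sq_nonneg _)
  obtain ⟨T, hT⟩ : ∃ T, ∀ m ∈ D₁ + D₂, τ m ≤ T := by
    obtain ⟨T, hT⟩ := ((hD₁.add hD₂).image τ).bddAbove
    exact ⟨T, fun m hm => hT (Set.mem_image_of_mem τ hm)⟩
  -- The factor exceeds the total `τ` of any pair, so `τ` only breaks ties.
  let w : M → ℕ := fun m => (2 * T + 1) * (w₁ (p₁ m) + w₂ (p₂ m)) + τ m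
  have hw : ∀ m, w m = (2 * T + 1) * (w₁ (p₁ m) + w₂ (p₂ m)) + τ m := fun _ => rfl
  have hmem₁ : ∀ m ∈ D₁ + D₂, p₁ m ∈ D₁ := by
    rintro _ ⟨x, hx, y, hy, rfl⟩; simpa only [hp₁ x hx y hy] using hx
  have hmem₂ : ∀ m ∈ D₁ + D₂, p₂ m ∈ D₂ := by
    rintro _ ⟨x, hx, y, hy, rfl⟩; simpa only [hp₂ x hx y hy] using hy
  have hsum : ∀ m ∈ D₁ + D₂, m = p₁ m + p₂ m := by
    rintro _ ⟨x, hx, y, hy, rfl⟩; simp only [hp₁ x hx y hy, hp₂ x hx y hy]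
  have arith : ∀ a b c d e : ℕ, c ≤ 2 * T →
      (2 * T + 1) * (a + d) + e ≤ (2 * T + 1) * (b + d) + c → a ≤ b := by
    intro a b c d e hc h
    by_contra hab
    push Not at hab
    have : (2 * T + 1) * (b + d + 1) ≤ (2 * T + 1) * (a + d) := Nat.mul_le_mul_left _ (by omega)
    rw [Nat.mul_add _ (b + d) 1] at this
    omega
  have low₁ : ∀ s, PairMinimal (D₁ + D₂) w s → PairMinimal D₁ w₁ (s.map p₁) := by
    rintro s ⟨hs, hmin⟩
    refine ⟨?_, ?_⟩
    · intro x hx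
      obtain ⟨m, hm, rfl⟩ := Multiset.mem_map.1 hx
      exact hmem₁ m (hs m hm)
    · intro x hx y hy x' hx' y' hy' hxy
      obtain ⟨m, hm, rfl⟩ := Multiset.mem_map.1 hx
      obtain ⟨n, hn, rfl⟩ := Multiset.mem_map.1 hy
      have hm2 := hmem₂ m (hs m hm)
      have hn2 := hmem₂ n (hs n hn)
      have hz := Set.add_mem_add hx' hm2
      have hz' := Set.add_mem_add hy' hn2
      have := hmin m hm n hn _ hz _ hz' (by
        conv_lhs => rw [hsum m (hs m hm), hsum n (hs n hn)]
        rw [add_add_add_comm, hxy, add_add_add_comm])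
      simp only [hw, hp₁ x' hx' _ hm2, hp₁ y' hy' _ hn2, hp₂ x' hx' _ hm2, hp₂ y' hy' _ hn2] at this
      have b1 := hT _ hz
      have b2 := hT _ hz'
      refine arith _ _ (τ (x' + p₂ m) + τ (y' + p₂ n)) (w₂ (p₂ m) + w₂ (p₂ n)) (τ m + τ n)
        (by omega) ?_
      linarith
  have low₂ : ∀ s, PairMinimal (D₁ + D₂) w s → PairMinimal D₂ w₂ (s.map p₂) := by
    rintro s ⟨hs, hmin⟩
    refine ⟨?_, ?_⟩
    · intro x hx
      obtain ⟨m, hm, rfl⟩ := Multiset.mem_map.1 hx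
      exact hmem₂ m (hs m hm)
    · intro x hx y hy x' hx' y' hy' hxy
      obtain ⟨m, hm, rfl⟩ := Multiset.mem_map.1 hx
      obtain ⟨n, hn, rfl⟩ := Multiset.mem_map.1 hy
      have hm1 := hmem₁ m (hs m hm)
      have hn1 := hmem₁ n (hs n hn)
      have hz := Set.add_mem_add hm1 hx'
      have hz' := Set.add_mem_add hn1 hy'
      have := hmin m hm n hn _ hz _ hz' (by
        conv_lhs => rw [hsum m (hs m hm), hsum n (hs n hn)]
        rw [add_add_add_comm, hxy, add_add_add_comm])
      simp only [hw, hp₁ _ hm1 x' hx', hp₁ _ hn1 y' hy', hp₂ _ hm1 x' hx', hp₂ _ hn1 y' hy'] at this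
      have b1 := hT _ hz
      have b2 := hT _ hz'
      refine arith _ _ (τ (p₁ m + x') + τ (p₁ n + y')) (w₁ (p₁ m) + w₁ (p₁ n)) (τ m + τ n)
        (by omega) ?_
      linarith
  let f : Bool → M → ℕ := fun i m => if i then r₁ (p₁ m) else r₂ (p₂ m)
  have chain : ∀ s, PairMinimal (D₁ + D₂) w s →
      ∀ m ∈ s, ∀ n ∈ s, (∀ i, f i m ≤ f i n) ∨ ∀ i, f i n ≤ f i m := by
    rintro s ⟨hs, hmin⟩ m hm n hn
    have hm1 := hmem₁ m (hs m hm)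
    have hn1 := hmem₁ n (hs n hn)
    have hm2 := hmem₂ m (hs m hm)
    have hn2 := hmem₂ n (hs n hn)
    have := hmin m hm n hn _ (Set.add_mem_add hm1 hn2) _ (Set.add_mem_add hn1 hm2) (by
        conv_lhs => rw [hsum m (hs m hm), hsum n (hs n hn)]
        abel)
    simp only [hw, hp₁ _ hm1 _ hn2, hp₁ _ hn1 _ hm2, hp₂ _ hm1 _ hn2, hp₂ _ hn1 _ hm2] at this
    have h3 : τ m + τ n ≤ τ (p₁ m + p₂ n) + τ (p₁ n + p₂ m) := by linarith
    zify at h3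
    simp only [hτ, hp₁ _ hm1 _ hn2, hp₁ _ hn1 _ hm2, hp₂ _ hm1 _ hn2, hp₂ _ hn1 _ hm2] at h3
    have h4 : 0 ≤ ((r₁ (p₁ m) : ℤ) - r₁ (p₁ n)) * ((r₂ (p₂ m) : ℤ) - r₂ (p₂ n)) := by nlinarith
    simp only [f, Bool.forall_bool, if_true, Bool.false_eq_true, if_false]
    rcases mul_nonneg_iff.1 h4 with ⟨a, b⟩ | ⟨a, b⟩
    · right; constructor <;> omega
    · left; constructor <;> omega
  refine ⟨w, fun s t hs ht hcard hst => ?_⟩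
  have e₁ : s.map p₁ = t.map p₁ := h₁ _ _ (low₁ s hs) (low₁ t ht) (by simpa using hcard)
    (by rw [← map_multiset_sum, ← map_multiset_sum, hst])
  have e₂ : s.map p₂ = t.map p₂ := h₂ _ _ (low₂ s hs) (low₂ t ht) (by simpa using hcard)
    (by rw [← map_multiset_sum, ← map_multiset_sum, hst])
  refine eq_of_chain f s t (chain s hs) (chain t ht) ?_ hcard ?_
  · intro m hm n hn h
    have hm := hs.1 m hm
    have hn := ht.1 n hn
    rw [hsum m hm, hsum n hn, hr₁ (hmem₁ m hm) (hmem₁ n hn) (by simpa [f] using h true),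
      hr₂ (hmem₂ m hm) (hmem₂ n hn) (by simpa [f] using h false)]
  · rintro (_ | _)
    · simpa [f, Multiset.map_map, Function.comp_def] using congrArg (Multiset.map r₂) e₂
    · simpa [f, Multiset.map_map, Function.comp_def] using congrArg (Multiset.map r₁) e₁

/-! ### Cut vectors and theta graphs -/

theorem Cut.separates_mk {V : Type u} (A : Set V) (x y : V) :
    (Cut.mk A).Separates s(x, y) ↔ ¬ (x ∈ A ↔ y ∈ A) := by
  change (∃ i ∈ A, ∃ j ∉ A, s(x, y) = s(i, j)) ↔ _
  constructor
  · rintro ⟨i, hi, j, hj, h⟩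
    rcases Sym2.eq_iff.1 h with ⟨rfl, rfl⟩ | ⟨rfl, rfl⟩ <;> tauto
  · intro h
    by_cases hx : x ∈ A
    · exact ⟨x, hx, y, by tauto, rfl⟩
    · exact ⟨y, by tauto, x, hx, Sym2.eq_swap⟩

open scoped Classical in
/-- The indicator function of the edges of `G` separated by a cut. -/
noncomputable def cutVec {V : Type u} (G : SimpleGraph V) (c : Cut V) : Sym2 V → ℕ :=
  fun e => if e ∈ G.edgeSet ∧ c.Separates e then 1 else 0

/-- The indicator functions of the edge sets of the cuts of `G`. -/
def cutVectors {V : Type u} (G : SimpleGraph V) : Set (Sym2 V → ℕ) := Set.range (cutVec G)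

open scoped Classical in
theorem cutVec_mk {V : Type u} (G : SimpleGraph V) (A : Set V) (x y : V) :
    cutVec G (Cut.mk A) s(x, y) = if G.Adj x y ∧ ¬ (x ∈ A ↔ y ∈ A) then 1 else 0 := by
  simp only [cutVec, Cut.separates_mk, SimpleGraph.mem_edgeSet]

theorem Cut.mk_compl {V : Type u} (A : Set V) : Cut.mk Aᶜ = Cut.mk A :=
  Quotient.sound (s := cutSetoid V) (Or.inr (compl_compl A).symm)

theorem Cut.exists_mk_notMem {V : Type u} (c : Cut V) (a : V) : ∃ A, a ∉ A ∧ c = Cut.mk A := by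
  obtain ⟨A, rfl⟩ := Quotient.exists_rep c
  by_cases h : a ∈ A
  · exact ⟨Aᶜ, fun h' => h' h, (Cut.mk_compl A).symm⟩
  · exact ⟨A, h, rfl⟩

instance {V : Type u} [Finite V] : Finite (Cut V) :=
  inferInstanceAs (Finite (Quotient (cutSetoid V)))

theorem cutVectors_finite {V : Type u} [Finite V] (G : SimpleGraph V) :
    (cutVectors G).Finite := Set.finite_range _

theorem multiset_eq_of_le_one {s t : Multiset ℕ} (hs : ∀ x ∈ s, x ≤ 1) (ht : ∀ x ∈ t, x ≤ 1)
    (hcard : s.card = t.card) (hsum : s.sum = t.sum) : s = t := by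
  have key : ∀ s : Multiset ℕ, (∀ x ∈ s, x ≤ 1) →
      s.count 1 = s.sum ∧ s.count 0 + s.sum = s.card := by
    intro s
    induction s using Multiset.induction_on with
    | empty => simp
    | cons a s ih =>
      intro h
      obtain ⟨h1, h2⟩ := ih fun x hx => h x (Multiset.mem_cons_of_mem hx)
      have ha := h a (Multiset.mem_cons_self a s)
      interval_cases a <;> simp [h1] <;> omega
  obtain ⟨s1, s0⟩ := key s hs
  obtain ⟨t1, t0⟩ := key t ht
  ext x
  rcases x with _ | _ | x
  · omega
  · simp only [zero_add]; omega
  · rw [Multiset.count_eq_zero_of_notMem fun h => by have := hs _ h; omega,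
      Multiset.count_eq_zero_of_notMem fun h => by have := ht _ h; omega]

/-- Strict concavity of `x * (n - x)`: spreading a pair apart while keeping its sum lowers the
total. It is applied to the cardinalities obtained when two incomparable sets are replaced by their
intersection and union. -/
theorem mul_sub_add_lt {n p q x y : ℕ} (hp : p < x) (hp' : p < y) (h : q + p = x + y) (hq : q ≤ n) :
    p * (n - p) + q * (n - q) < x * (n - x) + y * (n - y) := by
  have hx : x ≤ n := by omega
  have hy : y ≤ n := by omega
  have hpn : p ≤ n := by omega
  zify [hx, hy, hpn, hq]
  zify at hp hp' h
  have hq' : (q : ℤ) = x + y - p := by linarith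
  rw [hq']
  nlinarith [mul_pos (sub_pos.2 hp) (sub_pos.2 hp')]

open scoped Classical in
-- A cut is encoded by a bit `β`, telling whether it separates the poles, and by the set of `c ∈ C`
-- separated from `a`. The concave part of the weight makes these sets a chain for each value of
-- `β`. The term `β` minimises the number of pole-separating cuts when no edge `ab` records it. Then
-- both chains have determined sizes and coordinate sums.
theorem quadraticallyDetermined_theta {V : Type u} [Finite V] (G : SimpleGraph V) {a b : V}
    (hab : a ≠ b) (C : Finset V) (haC : a ∉ C) (hbC : b ∉ C)
    (hC : ∀ c ∈ C, G.Adj a c ∧ G.Adj b c)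
    (hE : ∀ x y, G.Adj x y →
      s(x, y) = s(a, b) ∨ ∃ c ∈ C, s(x, y) = s(a, c) ∨ s(x, y) = s(b, c))
    (hne : G.Adj a b ∨ C.Nonempty) : QuadraticallyDetermined (cutVectors G) := by
  obtain ⟨β, hβ⟩ : ∃ β : (Sym2 V → ℕ) → ℕ, ∀ A : Set V, a ∉ A →
      β (cutVec G (Cut.mk A)) = if b ∈ A then 1 else 0 := by
    rcases hne with h | ⟨c, hc⟩
    · refine ⟨fun m => m s(a, b), fun A hA => ?_⟩
      simp [cutVec_mk, h, hA]
    -- Without the edge `ab`, the bit is the parity of the cut along the path `a, c, b`.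
    · refine ⟨fun m => (m s(a, c) + m s(b, c)) % 2, fun A hA => ?_⟩
      simp only [cutVec_mk, hC c hc, hA]
      by_cases h1 : b ∈ A <;> by_cases h2 : c ∈ A <;> simp [h1, h2]
  have hβ1 : ∀ m ∈ cutVectors G, β m ≤ 1 := by
    rintro _ ⟨c, rfl⟩
    obtain ⟨A, hA, rfl⟩ := c.exists_mk_notMem a
    rw [hβ A hA]; split_ifs <;> omega
  have hle : ∀ m ∈ cutVectors G, ∀ e, m e ≤ 1 := by
    rintro _ ⟨c, rfl⟩ e
    unfold cutVec; split_ifs <;> omega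
  have hbc : ∀ m ∈ cutVectors G, ∀ c ∈ C,
      m s(b, c) = if β m = 1 then 1 - m s(a, c) else m s(a, c) := by
    rintro _ ⟨d, rfl⟩ c hc
    obtain ⟨A, hA, rfl⟩ := d.exists_mk_notMem a
    simp only [hβ A hA, cutVec_mk, hC c hc, hA]
    by_cases h1 : b ∈ A <;> by_cases h2 : c ∈ A <;> simp [h1, h2]
  have hadj : G.Adj a b → ∀ m ∈ cutVectors G, m s(a, b) = β m := by
    rintro h _ ⟨c, rfl⟩
    obtain ⟨A, hA, rfl⟩ := c.exists_mk_notMem a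
    simp [hβ A hA, cutVec_mk, h, hA]
  have real : ∀ k ≤ 1, ∀ S ⊆ C, ∃ m ∈ cutVectors G, β m = k ∧
      ∀ c ∈ C, m s(a, c) = if c ∈ S then 1 else 0 := by
    intro k hk S hS
    let A : Set V := {x | x ∈ S ∨ x = b ∧ k = 1}
    have hA : a ∉ A := by
      rintro (h | h)
      · exact haC (hS h)
      · exact hab h.1
    refine ⟨_, ⟨Cut.mk A, rfl⟩, ?_, fun c hc => ?_⟩
    · rw [hβ A hA]
      have : b ∉ S := fun h => hbC (hS h)
      simp only [A, Set.mem_ofPred_eq, this, false_or, true_and]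
      split_ifs <;> omega
    · have hcb : c ≠ b := by rintro rfl; exact hbC hc
      rw [cutVec_mk]
      simp [hC c hc, hA]
      simp [A, hcb]
  have ext2 : ∀ m ∈ cutVectors G, ∀ n ∈ cutVectors G, ∀ m' ∈ cutVectors G, ∀ n' ∈ cutVectors G,
      (G.Adj a b → β m + β n = β m' + β n') →
      (∀ c ∈ C, m s(a, c) + n s(a, c) = m' s(a, c) + n' s(a, c)) →
      (∀ c ∈ C, m s(b, c) + n s(b, c) = m' s(b, c) + n' s(b, c)) → m + n = m' + n' := by
    intro m hm n hn m' hm' n' hn' h1 h2 h3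
    funext e
    simp only [Pi.add_apply]
    by_cases he : e ∈ G.edgeSet
    · induction e with
      | h x y =>
      rw [SimpleGraph.mem_edgeSet] at he
      rcases hE x y he with h | ⟨c, hc, h | h⟩
      · have h4 : G.Adj a b := by rw [← SimpleGraph.mem_edgeSet, ← h]; exact he
        rw [h, hadj h4 m hm, hadj h4 n hn, hadj h4 m' hm', hadj h4 n' hn', h1 h4]
      · rw [h, h2 c hc]
      · rw [h, h3 c hc]
    · have : ∀ m ∈ cutVectors G, m e = 0 := by
        rintro _ ⟨c, rfl⟩; simp [cutVec, he]
      rw [this m hm, this n hn, this m' hm', this n' hn']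
  have ext1 : ∀ m ∈ cutVectors G, ∀ n ∈ cutVectors G, β m = β n →
      (∀ c ∈ C, m s(a, c) = n s(a, c)) → m = n := by
    intro m hm n hn h1 h2
    have := ext2 m hm m hm n hn n hn (fun _ => by rw [h1]) (fun c hc => by rw [h2 c hc])
      (fun c hc => by rw [hbc m hm c hc, hbc n hn c hc, h1, h2 c hc])
    funext e
    have := congrFun this e
    simp only [Pi.add_apply] at this
    omega
  let h : (Sym2 V → ℕ) → ℕ := fun m => ∑ c ∈ C, m s(a, c)
  have hcard : ∀ m, ∀ S ⊆ C, (∀ c ∈ C, m s(a, c) = if c ∈ S then 1 else 0) → h m = S.card := by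
    intro m S hS hm
    simp only [h]
    rw [Finset.sum_congr rfl hm, Finset.sum_boole, Finset.filter_mem_eq_inter,
      Finset.inter_eq_right.2 hS, Nat.cast_id]
  let w : (Sym2 V → ℕ) → ℕ := fun m => β m + h m * (C.card - h m)
  have supp : ∀ m ∈ cutVectors G, ∃ S ⊆ C, ∀ c ∈ C, m s(a, c) = if c ∈ S then 1 else 0 := by
    intro m hm
    refine ⟨C.filter fun c => m s(a, c) = 1, Finset.filter_subset _ _, fun c hc => ?_⟩
    have := hle m hm s(a, c)
    simp only [Finset.mem_filter, hc, true_and]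
    split_ifs <;> omega
  let f : {c // c ∈ C} → (Sym2 V → ℕ) → ℕ := fun c m => m s(a, c.1)
  have chain : ∀ s, PairMinimal (cutVectors G) w s → ∀ m ∈ s, ∀ n ∈ s, β m = β n →
      (∀ i, f i m ≤ f i n) ∨ ∀ i, f i n ≤ f i m := by
    rintro s ⟨hs, hmin⟩ m hm n hn hβmn
    have hmD := hs m hm
    have hnD := hs n hn
    obtain ⟨S, hS, hmS⟩ := supp m hmD
    obtain ⟨T, hT, hnT⟩ := supp n hnD
    by_cases hST : S ⊆ T
    · left
      rintro ⟨c, hc⟩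
      simp only [f, hmS c hc, hnT c hc]
      by_cases h1 : c ∈ S
      · simp [h1, hST h1]
      · simp [h1]
    by_cases hTS : T ⊆ S
    · right
      rintro ⟨c, hc⟩
      simp only [f, hmS c hc, hnT c hc]
      by_cases h1 : c ∈ T
      · simp [h1, hTS h1]
      · simp [h1]
    -- Incomparable `S` and `T` may be replaced by `S ∩ T` and `S ∪ T` with the same `β`, which is
    -- strictly lighter.
    exfalso
    have hI : S ∩ T ⊆ C := Finset.inter_subset_left.trans hS
    have hU : S ∪ T ⊆ C := Finset.union_subset hS hT
    obtain ⟨m', hm', hβm', hmS'⟩ := real (β m) (hβ1 m hmD) _ hI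
    obtain ⟨n', hn', hβn', hnS'⟩ := real (β m) (hβ1 m hmD) _ hU
    have hac : ∀ c ∈ C, m s(a, c) + n s(a, c) = m' s(a, c) + n' s(a, c) := by
      intro c hc
      rw [hmS c hc, hnT c hc, hmS' c hc, hnS' c hc]
      by_cases h1 : c ∈ S <;> by_cases h2 : c ∈ T <;> simp [h1, h2]
    have := hmin m hm n hn m' hm' n' hn' (ext2 m hmD n hnD m' hm' n' hn'
      (fun _ => by omega) hac (fun c hc => by
        have e1 := hac c hc
        have e2 := hle m hmD s(a, c)
        have e3 := hle n hnD s(a, c)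
        have e4 := hle m' hm' s(a, c)
        have e5 := hle n' hn' s(a, c)
        rw [hbc m hmD c hc, hbc n hnD c hc, hbc m' hm' c hc, hbc n' hn' c hc, hβm', hβn', ← hβmn]
        split_ifs <;> omega))
    simp only [w, hβm', hβn', ← hβmn, hcard m S hS hmS, hcard n T hT hnT, hcard m' _ hI hmS',
      hcard n' _ hU hnS'] at this
    have l1 : (S ∩ T).card < S.card := Finset.card_lt_card
      ⟨Finset.inter_subset_left, fun h => hST fun x hx => (Finset.mem_inter.1 (h hx)).2⟩
    have l2 : (S ∩ T).card < T.card := Finset.card_lt_card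
      ⟨Finset.inter_subset_right, fun h => hTS fun x hx => (Finset.mem_inter.1 (h hx)).1⟩
    have := mul_sub_add_lt l1 l2 (Finset.card_union_add_card_inter S T) (Finset.card_le_card hU)
    omega
  -- At `bc` a pole-separating cut has the complementary value to that at `ac`, all others the same
  -- value. So the sum at `ac` minus the sum at `bc` is twice the `β = 1` part of the sum at `ac`
  -- minus the number of cuts with `β = 1`.
  have count : ∀ s : Multiset (Sym2 V → ℕ), (∀ m ∈ s, m ∈ cutVectors G) → ∀ c ∈ C,
      s.sum s(a, c) = ((s.filter fun m => ¬ β m = 1).map fun m => m s(a, c)).sum +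
        ((s.filter fun m => β m = 1).map fun m => m s(a, c)).sum ∧
      s.sum s(b, c) + ((s.filter fun m => β m = 1).map fun m => m s(a, c)).sum =
        ((s.filter fun m => ¬ β m = 1).map fun m => m s(a, c)).sum +
          (s.filter fun m => β m = 1).card ∧
      ((s.filter fun m => β m = 1).map fun m => m s(a, c)).sum ≤
        (s.filter fun m => β m = 1).card := by
    intro s
    induction s using Multiset.induction_on with
    | empty => simp
    | cons m s ih =>
      intro hs c hc
      obtain ⟨e1, e2, e3⟩ := ih (fun m hm => hs m (Multiset.mem_cons_of_mem hm)) c hc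
      have hm := hs m (Multiset.mem_cons_self m s)
      have e4 := hbc m hm c hc
      have e5 := hle m hm s(a, c)
      by_cases h1 : β m = 1
      · simp only [h1, if_true] at e4
        simp only [Multiset.sum_cons, Pi.add_apply, h1, not_true_eq_false, not_false_eq_true,
          Multiset.filter_cons_of_pos, Multiset.filter_cons_of_neg, Multiset.map_cons,
          Multiset.card_cons]
        omega
      · simp only [h1, if_false] at e4
        simp only [Multiset.sum_cons, Pi.add_apply, h1, not_false_eq_true,
          Multiset.filter_cons_of_pos, Multiset.filter_cons_of_neg, Multiset.map_cons]
        omega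
  have le_of : ∀ s t : Multiset (Sym2 V → ℕ), PairMinimal (cutVectors G) w s →
      PairMinimal (cutVectors G) w t → s.sum = t.sum →
      (s.filter fun m => β m = 1).card ≤ (t.filter fun m => β m = 1).card := by
    intro s t hs ht hst
    by_cases hGab : G.Adj a b
    · have : ∀ s : Multiset (Sym2 V → ℕ), (∀ m ∈ s, m ∈ cutVectors G) →
          (s.filter fun m => β m = 1).card = s.sum s(a, b) := by
        intro s
        induction s using Multiset.induction_on with
        | empty => simp
        | cons m s ih =>
          intro hs
          have e1 := ih fun m hm => hs m (Multiset.mem_cons_of_mem hm)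
          have hm := hs m (Multiset.mem_cons_self m s)
          have e2 := hadj hGab m hm
          have e3 := hβ1 m hm
          by_cases h1 : β m = 1
          · simp [h1, e1, e2]; omega
          · simp [h1, e1, e2]; omega
      rw [this s hs.1, this t ht.1, hst]
    -- If `s` had more pole-separating cuts than `t`, equality of the sums would force the least of
    -- them to have the empty set and the greatest to have all of `C`. That pair can be traded for
    -- the pair with the same sets and `β = 0`, saving weight two.
    by_contra! hlt
    have hs1 : (s.filter fun m => β m = 1) ≠ 0 := Multiset.card_pos.1 (by omega)
    have hch : ∀ m ∈ s.filter fun m => β m = 1, ∀ n ∈ s.filter fun m => β m = 1,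
        (∀ i, f i m ≤ f i n) ∨ ∀ i, f i n ≤ f i m := by
      intro m hm n hn
      rw [Multiset.mem_filter] at hm hn
      exact chain s hs m hm.1 n hn.1 (hm.2.trans hn.2.symm)
    obtain ⟨m, hm, hmin⟩ := exists_least_of_total (fun m n => ∀ i, f i m ≤ f i n)
      (fun _ _ _ h h' i => (h i).trans (h' i)) _ hs1 hch
    obtain ⟨n, hn, hmax⟩ := exists_least_of_total (fun m n => ∀ i, f i n ≤ f i m)
      (fun _ _ _ h h' i => (h' i).trans (h i)) _ hs1 fun x hx y hy => hch y hy x hx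
    rw [Multiset.mem_filter] at hm hn
    have hm0 : ∀ c ∈ C, m s(a, c) = if c ∈ (∅ : Finset V) then 1 else 0 := by
      intro c hc
      obtain ⟨s1, s2, s3⟩ := count s hs.1 c hc
      obtain ⟨t1, t2, t3⟩ := count t ht.1 c hc
      rw [hst] at s1 s2
      rw [if_neg (Finset.notMem_empty c)]
      by_contra hne
      have : (s.filter fun m => β m = 1).card • 1 ≤
          ((s.filter fun m => β m = 1).map fun m => m s(a, c)).sum := by
        rw [← Multiset.card_map (fun m => m s(a, c))]
        refine Multiset.card_nsmul_le_sum fun x hx => ?_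
        obtain ⟨y, hy, rfl⟩ := Multiset.mem_map.1 hx
        have := hmin y hy ⟨c, hc⟩
        simp only [f] at this
        omega
      rw [smul_eq_mul] at this
      omega
    have hn1 : ∀ c ∈ C, n s(a, c) = if c ∈ C then 1 else 0 := by
      intro c hc
      obtain ⟨s1, s2, s3⟩ := count s hs.1 c hc
      obtain ⟨t1, t2, t3⟩ := count t ht.1 c hc
      rw [hst] at s1 s2
      rw [if_pos hc]
      have hle1 := hle n (hs.1 n hn.1) s(a, c)
      by_contra hne
      have : ((s.filter fun m => β m = 1).map fun m => m s(a, c)).sum = 0 := by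
        refine Multiset.sum_eq_zero fun x hx => ?_
        obtain ⟨y, hy, rfl⟩ := Multiset.mem_map.1 hx
        have := hmax y hy ⟨c, hc⟩
        simp only [f] at this
        omega
      omega
    obtain ⟨m', hm', hβm', hm0'⟩ := real 0 (by omega) ∅ (Finset.empty_subset C)
    obtain ⟨n', hn', hβn', hn1'⟩ := real 0 (by omega) C subset_rfl
    have hmD := hs.1 m hm.1
    have hnD := hs.1 n hn.1
    have hac : ∀ c ∈ C, m s(a, c) + n s(a, c) = m' s(a, c) + n' s(a, c) := fun c hc => by
      rw [hm0 c hc, hn1 c hc, hm0' c hc, hn1' c hc]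
    have := hs.2 m hm.1 n hn.1 m' hm' n' hn' (ext2 m hmD n hnD m' hm' n' hn'
      (fun h => absurd h hGab) hac (fun c hc => by
        rw [hbc m hmD c hc, hbc n hnD c hc, hbc m' hm' c hc, hbc n' hn' c hc, hβm', hβn', hm.2,
          hn.2, hm0 c hc, hn1 c hc, hm0' c hc, hn1' c hc]
        simp [hc]))
    simp only [w, hβm', hβn', hm.2, hn.2, hcard m _ (Finset.empty_subset C) hm0,
      hcard n _ subset_rfl hn1, hcard m' _ (Finset.empty_subset C) hm0',
      hcard n' _ subset_rfl hn1', Finset.card_empty, Nat.sub_self] at this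
    omega
  refine ⟨w, fun s t hs ht hst hsum => ?_⟩
  have hk : (s.filter fun m => β m = 1).card = (t.filter fun m => β m = 1).card :=
    le_antisymm (le_of s t hs ht hsum) (le_of t s ht hs hsum.symm)
  have hk0 : (s.filter fun m => ¬ β m = 1).card = (t.filter fun m => ¬ β m = 1).card := by
    have e1 := congrArg Multiset.card (Multiset.filter_add_not (fun m => β m = 1) s)
    have e2 := congrArg Multiset.card (Multiset.filter_add_not (fun m => β m = 1) t)
    rw [Multiset.card_add] at e1 e2
    omega
  have hmap : ∀ s : Multiset (Sym2 V → ℕ), (∀ m ∈ s, m ∈ cutVectors G) → ∀ (p : (Sym2 V → ℕ) → Prop)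
      [DecidablePred p] (i), ∀ x ∈ (s.filter p).map (f i), x ≤ 1 := by
    intro s hs p _ i x hx
    obtain ⟨m, hm, rfl⟩ := Multiset.mem_map.1 hx
    exact hle m (hs m (Multiset.mem_filter.1 hm).1) _
  have chain0 : ∀ s, PairMinimal (cutVectors G) w s → ∀ m ∈ s.filter fun m => ¬ β m = 1,
      ∀ n ∈ s.filter fun m => ¬ β m = 1, (∀ i, f i m ≤ f i n) ∨ ∀ i, f i n ≤ f i m := by
    intro s hs m hm n hn
    rw [Multiset.mem_filter] at hm hn
    have := hβ1 m (hs.1 m hm.1)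
    have := hβ1 n (hs.1 n hn.1)
    exact chain s hs m hm.1 n hn.1 (by omega)
  have chain1 : ∀ s, PairMinimal (cutVectors G) w s → ∀ m ∈ s.filter fun m => β m = 1,
      ∀ n ∈ s.filter fun m => β m = 1, (∀ i, f i m ≤ f i n) ∨ ∀ i, f i n ≤ f i m := by
    intro s hs m hm n hn
    rw [Multiset.mem_filter] at hm hn
    exact chain s hs m hm.1 n hn.1 (by omega)
  have e0 : (s.filter fun m => ¬ β m = 1) = t.filter fun m => ¬ β m = 1 := by
    refine eq_of_chain f _ _ (chain0 s hs) (chain0 t ht) ?_ hk0 fun i => ?_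
    · intro m hm n hn hi
      rw [Multiset.mem_filter] at hm hn
      have := hβ1 m (hs.1 m hm.1)
      have := hβ1 n (ht.1 n hn.1)
      exact ext1 m (hs.1 m hm.1) n (ht.1 n hn.1) (by omega) fun c hc => hi ⟨c, hc⟩
    · refine multiset_eq_of_le_one (hmap s hs.1 _ i) (hmap t ht.1 _ i) (by simpa using hk0) ?_
      obtain ⟨s1, s2, s3⟩ := count s hs.1 i.1 i.2
      obtain ⟨t1, t2, t3⟩ := count t ht.1 i.1 i.2
      rw [hsum] at s1 s2
      simp only [f]
      omega
  have e1 : (s.filter fun m => β m = 1) = t.filter fun m => β m = 1 := by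
    refine eq_of_chain f _ _ (chain1 s hs) (chain1 t ht) ?_ hk fun i => ?_
    · intro m hm n hn hi
      rw [Multiset.mem_filter] at hm hn
      exact ext1 m (hs.1 m hm.1) n (ht.1 n hn.1) (by omega) fun c hc => hi ⟨c, hc⟩
    · refine multiset_eq_of_le_one (hmap s hs.1 _ i) (hmap t ht.1 _ i) (by simpa using hk) ?_
      obtain ⟨s1, s2, s3⟩ := count s hs.1 i.1 i.2
      obtain ⟨t1, t2, t3⟩ := count t ht.1 i.1 i.2
      rw [hsum] at s1 s2
      simp only [f]
      omega
  rw [← Multiset.filter_add_not (fun m => β m = 1) s, e0, e1, Multiset.filter_add_not]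

/-! ### Long cycles and ears -/

theorem HasMinor.mono {V : Type u} {W : Type w} {G G' : SimpleGraph V} {H : SimpleGraph W}
    (hG : G ≤ G') (h : HasMinor G H) : HasMinor G' H := by
  obtain ⟨B, h1, h2, h3⟩ := h
  refine ⟨B, fun x => (h1 x).mono (SimpleGraph.comap_monotone _ hG), h2, fun x y hxy => ?_⟩
  obtain ⟨a, ha, b, hb, hab⟩ := h3 x y hxy
  exact ⟨a, ha, b, hb, hG hab⟩

theorem induce_singleton_connected {V : Type u} (G : SimpleGraph V) (x : V) :
    (G.induce {x}).Connected :=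
  ⟨SimpleGraph.Preconnected.of_subsingleton⟩

theorem hasMinor_completeGraph_four {V : Type u} {G : SimpleGraph V} {a b c d : V}
    (hab : G.Adj a b) (hac : G.Adj a c) (had : G.Adj a d) (hbc : G.Adj b c) (hbd : G.Adj b d)
    (hcd : G.Adj c d) : HasMinor G (SimpleGraph.completeGraph (Fin 4)) := by
  have key : ∀ i j : Fin 4, i ≠ j → G.Adj (![a, b, c, d] i) (![a, b, c, d] j) := by
    intro i j hij
    fin_cases i <;> fin_cases j <;> simp_all [SimpleGraph.adj_comm]
  refine ⟨fun i => {![a, b, c, d] i}, fun i => induce_singleton_connected G _, fun i j hij => ?_,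
    fun i j hij => ⟨_, rfl, _, rfl, key i j hij⟩⟩
  exact Set.disjoint_singleton.2 (key i j hij).ne

theorem hasMinor_cycleGraph_five_of_isPath {V : Type u} {G : SimpleGraph V} {x y : V}
    (p : G.Walk x y) (hp : p.IsPath) (hlen : 4 ≤ p.length) (hyx : G.Adj y x) :
    HasMinor G (SimpleGraph.cycleGraph 5) := by
  match p, hp, hlen with
  | .cons (v := v₁) h₁ (.cons (v := v₂) h₂ (.cons (v := v₃) h₃ (.cons (v := v₄) h₄ r))), hp, _ =>
    simp only [SimpleGraph.Walk.cons_isPath_iff, SimpleGraph.Walk.support_cons,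
      List.mem_cons, not_or] at hp
    -- The whole tail of the path is contracted to the fifth vertex, so any cycle of length at least
    -- five suffices.
    let B : Fin 5 → Set V := ![{x}, {v₁}, {v₂}, {v₃}, {v | v ∈ r.support}]
    have hsucc : ∀ i : Fin 5, ∃ a ∈ B i, ∃ b ∈ B (i + 1), G.Adj a b := by
      intro i
      fin_cases i
      · exact ⟨x, rfl, v₁, rfl, h₁⟩
      · exact ⟨v₁, rfl, v₂, rfl, h₂⟩
      · exact ⟨v₂, rfl, v₃, rfl, h₃⟩
      · exact ⟨v₃, rfl, v₄, r.start_mem_support, h₄⟩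
      · exact ⟨y, r.end_mem_support, x, rfl, hyx⟩
    have hdisj : ∀ i j : Fin 5, i < j → Disjoint (B i) (B j) := by
      intro i j hij
      fin_cases i <;> fin_cases j <;> first | exact absurd hij (by decide) | (simp [B]; tauto)
    refine ⟨B, fun i => ?_, fun i j hij => ?_, fun i j hij => ?_⟩
    · fin_cases i
      · exact induce_singleton_connected G x
      · exact induce_singleton_connected G v₁
      · exact induce_singleton_connected G v₂
      · exact induce_singleton_connected G v₃
      · exact r.connected_induce_support
    · rcases lt_or_gt_of_ne hij with h | h
      · exact hdisj i j h
      · exact (hdisj j i h).symm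
    · have : ∀ i j : Fin 5, (SimpleGraph.cycleGraph 5).Adj i j → j = i + 1 ∨ i = j + 1 := by
        decide
      rcases this i j hij with rfl | rfl
      · exact hsucc i
      · obtain ⟨a, ha, b, hb, hab⟩ := hsucc j
        exact ⟨b, hb, a, ha, hab.symm⟩

theorem hasMinor_cycleGraph_five_of_isPath_one {V : Type u} {G : SimpleGraph V} {x y h : V}
    (p : G.Walk x y) (hp : p.IsPath) (hlen : 3 ≤ p.length) (hh : h ∉ p.support)
    (hyh : G.Adj y h) (hhx : G.Adj h x) :
    HasMinor G (SimpleGraph.cycleGraph 5) :=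
  hasMinor_cycleGraph_five_of_isPath (.cons hhx p) (hp.cons hh) (by simpa using hlen) hyh

theorem hasMinor_cycleGraph_five_of_isPath_two {V : Type u} {G : SimpleGraph V} {x y h k : V}
    (p : G.Walk x y) (hp : p.IsPath) (hlen : 2 ≤ p.length) (hh : h ∉ p.support)
    (hk : k ∉ p.support) (hyh : G.Adj y h) (hhk : G.Adj h k) (hkx : G.Adj k x) :
    HasMinor G (SimpleGraph.cycleGraph 5) :=
  hasMinor_cycleGraph_five_of_isPath_one (.cons hkx p) (hp.cons hk) (by simpa using hlen)
    (by simp [hh, hhk.ne]) hyh hhk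

/-- There is a path from `x` to `y` of length at least two with no interior vertex in `W`. -/
def Ear {V : Type u} (G : SimpleGraph V) (W : Set V) (x y : V) : Prop :=
  ∃ p : G.Walk x y, p.IsPath ∧ 2 ≤ p.length ∧ ∀ v ∈ p.support, v ∈ W → v = x ∨ v = y

theorem Ear.symm {V : Type u} {G : SimpleGraph V} {W : Set V} {x y : V} (h : Ear G W x y) :
    Ear G W y x := by
  obtain ⟨p, hp, hlen, hW⟩ := h
  exact ⟨p.reverse, hp.reverse, by simpa using hlen, fun v hv hvW =>
    (hW v (by simpa using hv) hvW).symm⟩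

/-- A path of length two has an interior vertex adjacent to both ends. -/
theorem Ear.exists_adj_or {V : Type u} {G : SimpleGraph V} {W : Set V} {x y : V}
    (h : Ear G W x y) : (∃ d ∉ W, G.Adj x d ∧ G.Adj y d) ∨
      ∃ p : G.Walk x y, p.IsPath ∧ 3 ≤ p.length ∧ ∀ v ∈ p.support, v ∈ W → v = x ∨ v = y := by
  obtain ⟨p, hp, hlen, hW⟩ := h
  rcases hlen.eq_or_lt with hlen | hlen
  · left
    match p, hp, hlen, hW with
    | .cons (v := d) h₁ (.cons h₂ .nil), hp, _, hW =>
      refine ⟨d, fun hd => ?_, h₁, h₂.symm⟩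
      rcases hW d (by simp) hd with rfl | rfl
      · exact h₁.ne rfl
      · exact h₂.ne rfl
  · exact Or.inr ⟨p, hp, hlen, hW⟩

/-- Take the component of `u` outside `W`. Two distinct attachment vertices in `W` are joined by an
ear through the component; otherwise there is at most one, and it serves as `z`. -/
theorem exists_ear_or_separation {V : Type u} (G : SimpleGraph V) (W : Set V) {u : V}
    (hu : u ∉ W) : (∃ x ∈ W, ∃ y ∈ W, x ≠ y ∧ Ear G W x y) ∨
      ∃ (D : Set V) (z : V), u ∈ D ∧ (∀ d ∈ D, d ∉ W) ∧
        ∀ d ∈ D, ∀ v, G.Adj d v → v ∈ D ∨ v = z := by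
  classical
  let D : Set V := {v | ∃ p : G.Walk u v, ∀ x ∈ p.support, x ∉ W}
  have hDW : ∀ d ∈ D, d ∉ W := fun d ⟨p, hp⟩ => hp d p.end_mem_support
  have huD : u ∈ D := ⟨.nil, by simpa using hu⟩
  have hout : ∀ d ∈ D, ∀ v, G.Adj d v → v ∉ W → v ∈ D := by
    rintro d ⟨p, hp⟩ v hdv hv
    refine ⟨p.concat hdv, fun x hx => ?_⟩
    simp only [SimpleGraph.Walk.support_concat, List.mem_append, List.mem_singleton] at hx
    rcases hx with hx | rfl
    · exact hp x hx
    · exact hv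
  by_cases hz : ∃ z, ∃ d ∈ D, G.Adj d z ∧ z ∈ W
  · obtain ⟨x, d, hd, hdx, hxW⟩ := hz
    by_cases hy : ∃ y, y ≠ x ∧ ∃ d ∈ D, G.Adj d y ∧ y ∈ W
    · obtain ⟨y, hyx, d', hd', hdy, hyW⟩ := hy
      left
      refine ⟨x, hxW, y, hyW, hyx.symm, ?_⟩
      obtain ⟨p, hp⟩ := hd
      obtain ⟨p', hp'⟩ := hd'
      have hq : ∀ v ∈ (p.reverse.append p').bypass.support, v ∉ W := by
        intro v hv
        have := SimpleGraph.Walk.support_bypass_subset_support _ hv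
        rw [SimpleGraph.Walk.mem_support_append_iff, SimpleGraph.Walk.support_reverse,
          List.mem_reverse] at this
        exact this.elim (hp v) (hp' v)
      refine ⟨.cons hdx.symm ((p.reverse.append p').bypass.concat hdy), ?_, ?_, ?_⟩
      · refine SimpleGraph.Walk.IsPath.cons (SimpleGraph.Walk.IsPath.concat
          (SimpleGraph.Walk.bypass_isPath _) (fun h => hq y h hyW) _) ?_
        simp only [SimpleGraph.Walk.support_concat, List.mem_append, List.mem_singleton, not_or]
        exact ⟨fun h => hq x h hxW, hyx.symm⟩
      · simp
      · intro v hv hvW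
        simp only [SimpleGraph.Walk.support_cons, SimpleGraph.Walk.support_concat, List.mem_cons,
          List.mem_append, List.not_mem_nil, or_false] at hv
        rcases hv with rfl | hv | rfl
        · exact Or.inl rfl
        · exact absurd hvW (hq v hv)
        · exact Or.inr rfl
    · right
      refine ⟨D, x, huD, hDW, fun d hd v hdv => ?_⟩
      by_cases hv : v ∈ W
      · right
        by_contra hvx
        exact hy ⟨v, hvx, d, hd, hdv, hv⟩
      · exact Or.inl (hout d hd v hdv hv)
  · right
    -- With no attachment vertex `z` is irrelevant, and `u` is an arbitrary choice.
    refine ⟨D, u, huD, hDW, fun d hd v hdv => Or.inl (hout d hd v hdv fun hv => hz ?_)⟩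
    exact ⟨v, d, hd, hdv, hv⟩

/-! ### Gluing along at most one vertex -/

/-- The edges of `G` with no end in `D`. -/
def edgesAvoiding {V : Type u} (G : SimpleGraph V) (D : Set V) : SimpleGraph V where
  Adj x y := G.Adj x y ∧ x ∉ D ∧ y ∉ D
  symm := ⟨fun _ _ h => ⟨h.1.symm, h.2.2, h.2.1⟩⟩
  loopless := ⟨fun _ h => h.1.ne rfl⟩

/-- The edges of `G` with an end in `D`. -/
def edgesMeeting {V : Type u} (G : SimpleGraph V) (D : Set V) : SimpleGraph V where
  Adj x y := G.Adj x y ∧ (x ∈ D ∨ y ∈ D)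
  symm := ⟨fun _ _ h => ⟨h.1.symm, h.2.symm⟩⟩
  loopless := ⟨fun _ h => h.1.ne rfl⟩

open scoped Classical in
/-- The restriction of functions to the edges of `G`. -/
noncomputable def restrictEdges {V : Type u} (G : SimpleGraph V) :
    (Sym2 V → ℕ) →+ (Sym2 V → ℕ) where
  toFun f e := if e ∈ G.edgeSet then f e else 0
  map_zero' := by ext; simp
  map_add' f g := by ext e; by_cases h : e ∈ G.edgeSet <;> simp [h]

theorem restrictEdges_cutVec_add {V : Type u} {G H : SimpleGraph V}
    (h : Disjoint G.edgeSet H.edgeSet) (c d : Cut V) :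
    restrictEdges G (cutVec G c + cutVec H d) = cutVec G c := by
  ext e
  by_cases he : e ∈ G.edgeSet
  · simp [restrictEdges, cutVec, he, Set.disjoint_left.1 h he]
  · simp [restrictEdges, cutVec, he]

open scoped Pointwise in
-- Cuts of the two edge-disjoint parts can be chosen independently: after complementing, both have
-- `z` outside and agree at the only possible common vertex. Thus the cut vectors form a Minkowski
-- sum, with restriction to edges as the projections.
theorem QuadraticallyDetermined.of_separation {V : Type u} [Finite V] {G : SimpleGraph V}
    {D : Set V} {z : V} (hD : ∀ d ∈ D, ∀ v, G.Adj d v → v ∈ D ∨ v = z)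
    (h₁ : QuadraticallyDetermined (cutVectors (edgesAvoiding G D)))
    (h₂ : QuadraticallyDetermined (cutVectors (edgesMeeting G D))) :
    QuadraticallyDetermined (cutVectors G) := by
  have hdisj : Disjoint (edgesAvoiding G D).edgeSet (edgesMeeting G D).edgeSet := by
    refine Set.disjoint_left.2 fun e => ?_
    induction e with
    | h x y =>
    simp only [SimpleGraph.mem_edgeSet, edgesAvoiding, edgesMeeting]
    tauto
  have hglue : ∀ A B : Set V, (z ∈ A ↔ z ∈ B) → cutVec (edgesAvoiding G D) (Cut.mk A) +
      cutVec (edgesMeeting G D) (Cut.mk B) = cutVec G (Cut.mk {v | v ∈ D ∧ v ∈ B ∨ v ∉ D ∧ v ∈ A}) := by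
    intro A B hz
    ext e
    induction e with
    | h x y =>
    simp only [Pi.add_apply, cutVec_mk, edgesAvoiding, edgesMeeting, Set.mem_ofPred_eq]
    by_cases hxy : G.Adj x y
    · have h1 : x ∈ D → y ∈ D ∨ y = z := fun h => hD x h y hxy
      have h2 : y ∈ D → x ∈ D ∨ x = z := fun h => hD y h x hxy.symm
      clear h₁ h₂ hdisj hD
      split_ifs <;> first | rfl | (exfalso; grind)
    · simp [hxy]
  have heq : cutVectors G = cutVectors (edgesAvoiding G D) + cutVectors (edgesMeeting G D) := by
    ext m
    constructor
    · rintro ⟨c, rfl⟩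
      obtain ⟨A, -, rfl⟩ := c.exists_mk_notMem z
      refine ⟨_, ⟨Cut.mk A, rfl⟩, _, ⟨Cut.mk A, rfl⟩, ?_⟩
      simp only [hglue A A Iff.rfl]
      congr 2
      ext v
      simp only [Set.mem_ofPred_eq]
      tauto
    · rintro ⟨_, ⟨c, rfl⟩, _, ⟨d, rfl⟩, rfl⟩
      obtain ⟨A, hA, rfl⟩ := c.exists_mk_notMem z
      obtain ⟨B, hB, rfl⟩ := d.exists_mk_notMem z
      exact ⟨_, (hglue A B (by simp [hA, hB])).symm⟩
  rw [heq]
  refine QuadraticallyDetermined.add (cutVectors_finite _) (cutVectors_finite _)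
    (restrictEdges (edgesAvoiding G D)) (restrictEdges (edgesMeeting G D)) ?_ ?_ h₁ h₂
  · rintro _ ⟨c, rfl⟩ _ ⟨d, rfl⟩
    exact restrictEdges_cutVec_add hdisj c d
  · rintro _ ⟨c, rfl⟩ _ ⟨d, rfl⟩
    rw [add_comm]
    exact restrictEdges_cutVec_add hdisj.symm d c

theorem quadraticallyDetermined_bot {V : Type u} :
    QuadraticallyDetermined (cutVectors (⊥ : SimpleGraph V)) := by
  refine ⟨0, fun s t hs ht hcard _ => ?_⟩
  have key : ∀ s : Multiset (Sym2 V → ℕ), PairMinimal (cutVectors (⊥ : SimpleGraph V)) 0 s →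
      s = Multiset.replicate s.card 0 := by
    intro s hs
    refine Multiset.eq_replicate_card.2 fun m hm => ?_
    obtain ⟨c, rfl⟩ := hs.1 m hm
    ext e
    simp [cutVec]
  rw [key s hs, key t ht, hcard]

/-! ### Induction through theta subgraphs without ears -/

/-- The ends `a`, `b` and their common neighbours. -/
def thetaVerts {V : Type u} (G : SimpleGraph V) (a b : V) : Set V :=
  {v | v = a ∨ v = b ∨ G.Adj a v ∧ G.Adj b v}

/-- Either all edges lie within the theta subgraph, or an outside vertex yields a separation. In the
latter case both parts are proper: one loses the edge `uv`, the other loses an edge of the theta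
subgraph. -/
theorem QuadraticallyDetermined.of_no_ear {V : Type u} [Finite V] {G : SimpleGraph V}
    (ih : ∀ H < G, QuadraticallyDetermined (cutVectors H)) {a b : V} (hab : a ≠ b)
    (hne : G.Adj a b ∨ ∃ c, G.Adj a c ∧ G.Adj b c)
    (hchord : ∀ c c', G.Adj a c → G.Adj b c → G.Adj a c' → G.Adj b c' → ¬ G.Adj c c')
    (hear_ab : ¬ Ear G (thetaVerts G a b) a b)
    (hear_a : ∀ c, G.Adj a c → G.Adj b c → ¬ Ear G (thetaVerts G a b) a c)
    (hear_b : ∀ c, G.Adj a c → G.Adj b c → ¬ Ear G (thetaVerts G a b) b c)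
    (hear_c : ∀ c c', c ≠ c' → G.Adj a c → G.Adj b c → G.Adj a c' → G.Adj b c' →
      ¬ Ear G (thetaVerts G a b) c c') :
    QuadraticallyDetermined (cutVectors G) := by
  classical
  by_cases hall : ∀ x y, G.Adj x y → x ∈ thetaVerts G a b
  · have := Fintype.ofFinite V
    refine quadraticallyDetermined_theta G hab
      (Finset.univ.filter fun c => G.Adj a c ∧ G.Adj b c) (by simp) (by simp) (by simp) ?_ ?_
    · intro x y hxy
      have h1 := hall x y hxy
      have h2 := hall y x hxy.symm
      simp only [Finset.mem_filter, Finset.mem_univ, true_and]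
      rcases h1 with rfl | rfl | h1 <;> rcases h2 with rfl | rfl | h2
      · exact absurd rfl hxy.ne
      · exact Or.inl rfl
      · exact Or.inr ⟨y, h2, Or.inl rfl⟩
      · exact Or.inl Sym2.eq_swap
      · exact absurd rfl hxy.ne
      · exact Or.inr ⟨y, h2, Or.inr rfl⟩
      · exact Or.inr ⟨x, h1, Or.inl Sym2.eq_swap⟩
      · exact Or.inr ⟨x, h1, Or.inr Sym2.eq_swap⟩
      · exact absurd hxy (hchord x y h1.1 h1.2 h2.1 h2.2)
    · refine hne.imp_right ?_
      rintro ⟨c, hc⟩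
      exact ⟨c, by simpa using hc⟩
  · push Not at hall
    obtain ⟨u, v, huv, hu⟩ := hall
    rcases exists_ear_or_separation G (thetaVerts G a b) hu with
      ⟨x, hx, y, hy, hxy, he⟩ | ⟨D, z, huD, hDW, hD⟩
    · exfalso
      rcases hx with rfl | rfl | hx <;> rcases hy with rfl | rfl | hy
      · exact hxy rfl
      · exact hear_ab he
      · exact hear_a y hy.1 hy.2 he
      · exact hear_ab he.symm
      · exact hxy rfl
      · exact hear_b y hy.1 hy.2 he
      · exact hear_a x hx.1 hx.2 he.symm
      · exact hear_b x hx.1 hx.2 he.symm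
      · exact hear_c x y hxy hx.1 hx.2 hy.1 hy.2 he
    · obtain ⟨x, y, hx, hy, hxy⟩ : ∃ x y, x ∈ thetaVerts G a b ∧ y ∈ thetaVerts G a b ∧ G.Adj x y := by
        rcases hne with h | ⟨c, hc⟩
        · exact ⟨a, b, Or.inl rfl, Or.inr (Or.inl rfl), h⟩
        · exact ⟨a, c, Or.inl rfl, Or.inr (Or.inr hc), hc.1⟩
      refine QuadraticallyDetermined.of_separation hD (ih _ ?_) (ih _ ?_)
      · refine lt_of_le_not_ge (fun _ _ h => h.1) fun h => ?_
        exact (h huv).2.1 huD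
      · refine lt_of_le_not_ge (fun _ _ h => h.1) fun h => ?_
        exact (h hxy).2.elim (fun h => hDW x h hx) (fun h => hDW y h hy)

theorem thetaVerts_comm {V : Type u} (G : SimpleGraph V) (a b : V) :
    thetaVerts G a b = thetaVerts G b a := by
  ext v
  simp only [thetaVerts, Set.mem_ofPred_eq]
  tauto

/-- The interior vertex of an ear of length two would itself be a common neighbour; a longer ear
closes up through `c` to a cycle of length at least five. -/
theorem not_ear_ends {V : Type u} {G : SimpleGraph V}
    (hC5 : ¬ HasMinor G (SimpleGraph.cycleGraph 5)) {a b : V} {c : V}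
    (hac : G.Adj a c) (hbc : G.Adj b c) :
    ¬ Ear G (thetaVerts G a b) a b := by
  intro he
  rcases he.exists_adj_or with ⟨d, hd, had, hbd⟩ | ⟨p, hp, hlen, hW⟩
  · exact hd (Or.inr (Or.inr ⟨had, hbd⟩))
  · refine hC5 (hasMinor_cycleGraph_five_of_isPath_one p hp hlen (fun h => ?_) hbc hac.symm)
    rcases hW c h (Or.inr (Or.inr ⟨hac, hbc⟩)) with rfl | rfl
    · exact hac.ne rfl
    · exact hbc.ne rfl

/-- The ear closes up along `c, b, c', a`, which adds three edges to at least two. -/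
theorem not_ear_left {V : Type u} {G : SimpleGraph V}
    (hC5 : ¬ HasMinor G (SimpleGraph.cycleGraph 5)) {a b : V} (hab : a ≠ b) {c c' : V}
    (hcc' : c' ≠ c) (hac : G.Adj a c) (hbc : G.Adj b c)
    (hac' : G.Adj a c') (hbc' : G.Adj b c') : ¬ Ear G (thetaVerts G a b) a c := by
  rintro ⟨p, hp, hlen, hW⟩
  refine hC5 (hasMinor_cycleGraph_five_of_isPath_two p hp hlen (fun h => ?_) (fun h => ?_)
    hbc.symm hbc' hac'.symm)
  · rcases hW b h (Or.inr (Or.inl rfl)) with rfl | rfl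
    · exact hab rfl
    · exact hbc.ne rfl
  · rcases hW c' h (Or.inr (Or.inr ⟨hac', hbc'⟩)) with rfl | rfl
    · exact hac'.ne rfl
    · exact hcc' rfl

theorem not_ear_right {V : Type u} {G : SimpleGraph V}
    (hC5 : ¬ HasMinor G (SimpleGraph.cycleGraph 5)) {a b : V} (hab : a ≠ b) {c c' : V}
    (hcc' : c' ≠ c) (hac : G.Adj a c) (hbc : G.Adj b c)
    (hac' : G.Adj a c') (hbc' : G.Adj b c') : ¬ Ear G (thetaVerts G a b) b c := by
  rw [thetaVerts_comm]
  exact not_ear_left hC5 hab.symm hcc' hbc hac hbc' hac'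

/-- The poles are taken from the richest configuration present: adjacent vertices with two common
neighbours, then a pair with three common neighbours, a 4-cycle, a triangle, and finally a single
edge. The absence of the richer configurations excludes the short ears, and the absence of a `C₅`
minor excludes the long ones. -/
theorem quadraticallyDetermined_of_minorFree {V : Type u} [Finite V] (G : SimpleGraph V)
    (hK4 : ¬ HasMinor G (SimpleGraph.completeGraph (Fin 4)))
    (hC5 : ¬ HasMinor G (SimpleGraph.cycleGraph 5)) :
    QuadraticallyDetermined (cutVectors G) := by
  induction G using WellFoundedLT.induction with
  | ind G ih =>
  replace ih : ∀ H < G, QuadraticallyDetermined (cutVectors H) := fun H hH =>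
    ih H hH (fun h => hK4 (h.mono hH.le)) (fun h => hC5 (h.mono hH.le))
  have third : ∀ {x y : V}, x ≠ y → ∀ c, ∃ z, (z = x ∨ z = y) ∧ z ≠ c := by
    intro x y hxy c
    by_cases h : x = c
    · exact ⟨y, Or.inr rfl, fun h' => hxy (h.trans h'.symm)⟩
    · exact ⟨x, Or.inl rfl, h⟩
  -- an edge with two common neighbours of its ends
  by_cases hI : ∃ a b c c', G.Adj a b ∧ c ≠ c' ∧ G.Adj a c ∧ G.Adj b c ∧ G.Adj a c' ∧ G.Adj b c'
  · obtain ⟨a, b, x, y, hab, hxy, hax, hbx, hay, hby⟩ := hI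
    have other : ∀ c, ∃ c', c' ≠ c ∧ G.Adj a c' ∧ G.Adj b c' := by
      intro c
      obtain ⟨z, rfl | rfl, hz⟩ := third hxy c
      · exact ⟨z, hz, hax, hbx⟩
      · exact ⟨z, hz, hay, hby⟩
    refine .of_no_ear ih hab.ne (Or.inl hab) ?_ (not_ear_ends hC5 hax hbx) ?_ ?_ ?_
    · intro c c' h1 h2 h3 h4 h5
      exact hK4 (hasMinor_completeGraph_four hab h1 h3 h2 h4 h5)
    · intro c h1 h2
      obtain ⟨c', h3, h4, h5⟩ := other c
      exact not_ear_left hC5 hab.ne h3 h1 h2 h4 h5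
    · intro c h1 h2
      obtain ⟨c', h3, h4, h5⟩ := other c
      exact not_ear_right hC5 hab.ne h3 h1 h2 h4 h5
    · rintro c c' hcc' h1 h2 h3 h4 ⟨p, hp, hlen, hW⟩
      refine hC5 (hasMinor_cycleGraph_five_of_isPath_two p hp hlen (fun h => ?_) (fun h => ?_)
        h3.symm hab h2)
      · rcases hW a h (Or.inl rfl) with rfl | rfl
        · exact h1.ne rfl
        · exact h3.ne rfl
      · rcases hW b h (Or.inr (Or.inl rfl)) with rfl | rfl
        · exact h2.ne rfl
        · exact h4.ne rfl
  -- two vertices with two common neighbours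
  by_cases hII : ∃ a b c c', a ≠ b ∧ c ≠ c' ∧ G.Adj a c ∧ G.Adj b c ∧ G.Adj a c' ∧ G.Adj b c'
  · have main : ∀ a b x y, a ≠ b → x ≠ y → G.Adj a x → G.Adj b x → G.Adj a y → G.Adj b y →
        (∀ c c', c ≠ c' → G.Adj a c → G.Adj b c → G.Adj a c' → G.Adj b c' →
          ¬ Ear G (thetaVerts G a b) c c') → QuadraticallyDetermined (cutVectors G) := by
      intro a b x y hab hxy hax hbx hay hby hear
      have other : ∀ c, ∃ c', c' ≠ c ∧ G.Adj a c' ∧ G.Adj b c' := by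
        intro c
        obtain ⟨z, rfl | rfl, hz⟩ := third hxy c
        · exact ⟨z, hz, hax, hbx⟩
        · exact ⟨z, hz, hay, hby⟩
      refine .of_no_ear ih hab (Or.inr ⟨x, hax, hbx⟩) ?_ (not_ear_ends hC5 hax hbx) ?_ ?_ hear
      · intro c c' h1 h2 h3 h4 h5
        exact hI ⟨c, c', a, b, h5, hab, h1.symm, h3.symm, h2.symm, h4.symm⟩
      · intro c h1 h2
        obtain ⟨c', h3, h4, h5⟩ := other c
        exact not_ear_left hC5 hab h3 h1 h2 h4 h5
      · intro c h1 h2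
        obtain ⟨c', h3, h4, h5⟩ := other c
        exact not_ear_right hC5 hab h3 h1 h2 h4 h5
    -- With a third common neighbour `d`, an ear from `c` to `c'` closes up through `a, d, b` to a
    -- cycle of length at least six. If no pair has three common neighbours, an ear of length two is
    -- impossible because its interior vertex would be a third one for `c` and `c'`.
    by_cases hIII : ∃ a b x y z, a ≠ b ∧ x ≠ y ∧ x ≠ z ∧ y ≠ z ∧ G.Adj a x ∧ G.Adj b x ∧
        G.Adj a y ∧ G.Adj b y ∧ G.Adj a z ∧ G.Adj b z
    · obtain ⟨a, b, x, y, z, hab, hxy, hxz, hyz, hax, hbx, hay, hby, haz, hbz⟩ := hIII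
      refine main a b x y hab hxy hax hbx hay hby ?_
      rintro c c' hcc' h1 h2 h3 h4 ⟨p, hp, hlen, hW⟩
      obtain ⟨d, hdc, hdc', had, hbd⟩ : ∃ d, d ≠ c ∧ d ≠ c' ∧ G.Adj a d ∧ G.Adj b d := by
        by_cases e1 : x ≠ c ∧ x ≠ c'
        · exact ⟨x, e1.1, e1.2, hax, hbx⟩
        by_cases e2 : y ≠ c ∧ y ≠ c'
        · exact ⟨y, e2.1, e2.2, hay, hby⟩
        · exact ⟨z, by grind, by grind, haz, hbz⟩
      have ha : a ∉ p.support := fun h => (hW a h (Or.inl rfl)).elim h1.ne h3.ne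
      have hb : b ∉ p.support := fun h => (hW b h (Or.inr (Or.inl rfl))).elim h2.ne h4.ne
      have hd : d ∉ p.support := fun h =>
        (hW d h (Or.inr (Or.inr ⟨had, hbd⟩))).elim hdc hdc'
      refine hC5 (hasMinor_cycleGraph_five_of_isPath_two (.cons h2 p) (hp.cons hb)
        (by simp only [SimpleGraph.Walk.length_cons]; omega) (h := a) (k := d) ?_ ?_ h3.symm had
        hbd.symm)
      · simp [hab, ha]
      · simp [hbd.ne.symm, hd]
    · obtain ⟨a, b, x, y, hab, hxy, hax, hbx, hay, hby⟩ := hII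
      refine main a b x y hab hxy hax hbx hay hby ?_
      intro c c' hcc' h1 h2 h3 h4 he
      rcases he.exists_adj_or with ⟨d, hd, hcd, hcd'⟩ | ⟨p, hp, hlen, hW⟩
      · refine hIII ⟨c, c', a, b, d, hcc', hab, ?_, ?_, h1.symm, h3.symm, h2.symm, h4.symm, hcd,
          hcd'⟩
        · rintro rfl; exact hd (Or.inl rfl)
        · rintro rfl; exact hd (Or.inr (Or.inl rfl))
      · refine hC5 (hasMinor_cycleGraph_five_of_isPath_one p hp hlen (fun h => ?_) h3.symm h1)
        exact (hW a h (Or.inl rfl)).elim h1.ne h3.ne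
  have uniq : ∀ a b c c', a ≠ b → G.Adj a c → G.Adj b c → G.Adj a c' → G.Adj b c' → c = c' := by
    intro a b c c' hab h1 h2 h3 h4
    by_contra hcc'
    exact hII ⟨a, b, c, c', hab, hcc', h1, h2, h3, h4⟩
  -- a triangle
  by_cases hIV : ∃ a b c, G.Adj a b ∧ G.Adj a c ∧ G.Adj b c
  · have triangle : ∀ a b c, G.Adj a b → G.Adj a c → G.Adj b c →
        ¬ Ear G (thetaVerts G a b) a c := by
      intro a b c hab hac hbc he
      rcases he.exists_adj_or with ⟨d, hd, had, hcd⟩ | ⟨p, hp, hlen, hW⟩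
      · exact hd (Or.inr (Or.inl (uniq a c d b hac.ne had hcd hab hbc.symm)))
      · refine hC5 (hasMinor_cycleGraph_five_of_isPath_one p hp hlen (fun h => ?_) hbc.symm
          hab.symm)
        exact (hW b h (Or.inr (Or.inl rfl))).elim hab.ne.symm hbc.ne
    obtain ⟨a, b, c, hab, hac, hbc⟩ := hIV
    refine .of_no_ear ih hab.ne (Or.inl hab) ?_ (not_ear_ends hC5 hac hbc)
      (fun c h1 h2 => triangle a b c hab h1 h2) ?_ ?_
    · intro c c' h1 h2 h3 h4 h5
      exact h5.ne (uniq a b c c' hab.ne h1 h2 h3 h4)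
    · intro c h1 h2
      rw [thetaVerts_comm]
      exact triangle b a c hab.symm h2 h1
    · intro c c' hcc' h1 h2 h3 h4
      exact absurd (uniq a b c c' hab.ne h1 h2 h3 h4) hcc'
  -- Without triangles or 4-cycles every edge is a bridge, so the theta subgraph is the edge alone.
  by_cases hV : ∃ a b, G.Adj a b
  · obtain ⟨a, b, hab⟩ := hV
    have htri : ∀ c, G.Adj a c → ¬ G.Adj b c := fun c h1 h2 => hIV ⟨a, b, c, hab, h1, h2⟩
    refine .of_no_ear ih hab.ne (Or.inl hab) (fun c _ h1 h2 => absurd h2 (htri c h1)) ?_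
      (fun c h1 h2 => absurd h2 (htri c h1)) (fun c h1 h2 => absurd h2 (htri c h1))
      (fun c _ _ h1 h2 => absurd h2 (htri c h1))
    intro he
    rcases he.exists_adj_or with ⟨d, hd, had, hbd⟩ | ⟨p, hp, hlen, hW⟩
    · exact htri d had hbd
    · rcases hlen.eq_or_lt with hlen | hlen
      · match p, hp, hlen with
        | .cons (v := d₁) h₁ (.cons (v := d₂) h₂ (.cons h₃ .nil)), hp, _ =>
          simp only [SimpleGraph.Walk.cons_isPath_iff, SimpleGraph.Walk.support_cons,
            SimpleGraph.Walk.support_nil, List.mem_cons, not_or] at hp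
          have := uniq a d₂ d₁ b hp.2.2.1 h₁ h₂.symm hab h₃
          exact hp.1.2.2.1 this
      · exact hC5 (hasMinor_cycleGraph_five_of_isPath p hp hlen hab.symm)
  · obtain rfl : G = ⊥ := by
      ext a b
      simp only [SimpleGraph.bot_adj, iff_false]
      exact fun h => hV ⟨a, b, h⟩
    exact quadraticallyDetermined_bot

/-! ### Weighted monomial orders -/

/-- The functions `σ →₀ ℕ`, ordered by weight and then lexicographically. -/
def WeightLex {σ : Type u} (_W : σ → ℕ) : Type u := σ →₀ ℕ

noncomputable instance {σ : Type u} (W : σ → ℕ) : AddCommMonoid (WeightLex W) :=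
  inferInstanceAs (AddCommMonoid (σ →₀ ℕ))

/-- The key by which `WeightLex` is ordered. -/
noncomputable def WeightLex.key {σ : Type u} (W : σ → ℕ) :
    WeightLex W → ℕ ×ₗ Lex (σ →₀ ℕ) :=
  fun a => toLex (Finsupp.weight W a, toLex a)

theorem WeightLex.key_injective {σ : Type u} (W : σ → ℕ) : Function.Injective (key W) :=
  fun _ _ h => toLex_inj.1 (Prod.ext_iff.1 (toLex_inj.1 h)).2

theorem WeightLex.key_add {σ : Type u} (W : σ → ℕ) (a b : WeightLex W) :
    key W (a + b) = key W a + key W b :=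
  congrArg (fun n => toLex (n, toLex (a + b : σ →₀ ℕ))) (map_add (Finsupp.weight W) a b)

noncomputable instance {σ : Type u} [LinearOrder σ] (W : σ → ℕ) : LinearOrder (WeightLex W) :=
  LinearOrder.lift' (WeightLex.key W) (WeightLex.key_injective W)

theorem WeightLex.le_iff {σ : Type u} [LinearOrder σ] {W : σ → ℕ} {a b : WeightLex W} :
    a ≤ b ↔ key W a ≤ key W b := Iff.rfl

theorem WeightLex.lt_iff {σ : Type u} [LinearOrder σ] {W : σ → ℕ} {a b : WeightLex W} :
    a < b ↔ key W a < key W b := Iff.rfl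

instance {σ : Type u} [LinearOrder σ] (W : σ → ℕ) : IsOrderedAddMonoid (WeightLex W) where
  add_le_add_left a b h c := by
    rw [WeightLex.le_iff, WeightLex.key_add, WeightLex.key_add]
    exact add_le_add_left (WeightLex.le_iff.1 h) _

instance {σ : Type u} [LinearOrder σ] [Finite σ] (W : σ → ℕ) : WellFoundedLT (WeightLex W) :=
  ⟨InvImage.wf (WeightLex.key W) wellFounded_lt⟩

/-- The monomial order which compares weights and then breaks ties lexicographically. -/
noncomputable def weightLex {σ : Type u} [LinearOrder σ] [Finite σ] (W : σ → ℕ) :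
    MonomialOrder.{u, u} σ where
  syn := WeightLex W
  toSyn := { toEquiv := Equiv.refl (σ →₀ ℕ), map_add' := fun _ _ => rfl }
  toSyn_monotone a b h := by
    obtain ⟨c, rfl⟩ := exists_add_of_le h
    rw [WeightLex.le_iff]
    change WeightLex.key W a ≤ WeightLex.key W (a + c)
    refine Prod.Lex.toLex_le_toLex.2 ?_
    rcases (Nat.le_add_right (Finsupp.weight W a) (Finsupp.weight W c)).lt_or_eq with h' | h'
    · exact Or.inl (by rwa [← map_add] at h')
    · exact Or.inr ⟨by rwa [← map_add] at h', Finsupp.toLex_monotone h⟩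

theorem weightLex_lt_of_weight_lt {σ : Type u} [LinearOrder σ] [Finite σ] {W : σ → ℕ}
    {a b : σ →₀ ℕ} (h : Finsupp.weight W a < Finsupp.weight W b) :
    (weightLex W).toSyn a < (weightLex W).toSyn b :=
  WeightLex.lt_iff.2 (Prod.Lex.toLex_lt_toLex.2 (Or.inl h))

/-! ### From fibres of exponents to Gröbner bases -/

open scoped Classical in
/-- The exponent of the image of the variable indexed by `c` under `cutHom`. -/
noncomputable def cutExponent {V : Type u} [Fintype V] (G : SimpleGraph V) (c : Cut V) :
    Option G.edgeSet →₀ ℕ :=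
  Finsupp.single none 1 +
    ∑ e : G.edgeSet, if c.Separates (e : Sym2 V) then Finsupp.single (some e) 1 else 0

/-- The exponent of the image of a monomial under `cutHom`. -/
noncomputable def imageExponent {V : Type u} [Fintype V] (G : SimpleGraph V) :
    (Cut V →₀ ℕ) →ₗ[ℕ] (Option G.edgeSet →₀ ℕ) :=
  Finsupp.linearCombination ℕ (cutExponent G)

theorem cutExponent_none {V : Type u} [Fintype V] (G : SimpleGraph V) (c : Cut V) :
    cutExponent G c none = 1 := by
  classical
  simp only [cutExponent, Finsupp.add_apply, Finsupp.single_eq_same, Finsupp.finsetSum_apply]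
  rw [Finset.sum_eq_zero, add_zero]
  intro e _
  split_ifs <;> simp

theorem cutExponent_some {V : Type u} [Fintype V] (G : SimpleGraph V) (c : Cut V) (e : G.edgeSet) :
    cutExponent G c (some e) = cutVec G c e := by
  classical
  simp only [cutExponent, Finsupp.add_apply, Finsupp.finsetSum_apply]
  rw [Finset.sum_eq_single e]
  · by_cases h : c.Separates (e : Sym2 V) <;> simp [cutVec, h]
  · intro e' _ he'
    split_ifs <;> simp [he']
  · simp

theorem imageExponent_none {V : Type u} [Fintype V] (G : SimpleGraph V) (u : Cut V →₀ ℕ) :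
    imageExponent G u none = u.degree := by
  induction u using Finsupp.induction_linear with
  | zero => simp
  | add u v hu hv => simp [hu, hv]
  | single c n => simp [imageExponent, cutExponent_none]

theorem imageExponent_some {V : Type u} [Fintype V] (G : SimpleGraph V) (u : Cut V →₀ ℕ)
    (e : G.edgeSet) :
    imageExponent G u (some e) = ((Finsupp.toMultiset u).map (cutVec G)).sum e := by
  induction u using Finsupp.induction_linear with
  | zero => simp
  | add u v hu hv => simp [hu, hv]
  | single c n => simp [imageExponent, cutExponent_some, Multiset.map_nsmul, Multiset.sum_nsmul]

theorem imageExponent_eq_iff {V : Type u} [Fintype V] (G : SimpleGraph V) (u v : Cut V →₀ ℕ) :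
    imageExponent G u = imageExponent G v ↔ u.degree = v.degree ∧
      ((Finsupp.toMultiset u).map (cutVec G)).sum = ((Finsupp.toMultiset v).map (cutVec G)).sum := by
  constructor
  · intro h
    refine ⟨by rw [← imageExponent_none G, h, imageExponent_none], ?_⟩
    funext e
    by_cases he : e ∈ G.edgeSet
    · rw [← imageExponent_some G u ⟨e, he⟩, h, imageExponent_some]
    · have : ∀ s : Multiset (Cut V), (s.map (cutVec G)).sum e = 0 := by
        intro s
        induction s using Multiset.induction_on with
        | empty => simp
        | cons c s ih => simp [ih, cutVec, he]
      rw [this, this]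
  · rintro ⟨h1, h2⟩
    ext (_ | e)
    · rw [imageExponent_none, imageExponent_none, h1]
    · rw [imageExponent_some, imageExponent_some, h2]

theorem cutHom_monomial (K : Type v) [Field K] {V : Type u} [Fintype V] (G : SimpleGraph V)
    (u : Cut V →₀ ℕ) (r : K) :
    cutHom K G (MvPolynomial.monomial u r) = MvPolynomial.monomial (imageExponent G u) r := by
  classical
  have hX : ∀ c, (MvPolynomial.X none * ∏ e : G.edgeSet,
      if c.Separates (e : Sym2 V) then MvPolynomial.X (some e) else 1 :
        MvPolynomial (Option G.edgeSet) K) = MvPolynomial.monomial (cutExponent G c) 1 := by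
    intro c
    rw [cutExponent, ← one_mul (1 : K), ← MvPolynomial.monomial_mul,
      MvPolynomial.monomial_sum_one]
    congr 1
    refine Finset.prod_congr rfl fun e _ => ?_
    split_ifs <;> rfl
  rw [cutHom, MvPolynomial.aeval_monomial]
  simp only [hX, MvPolynomial.monomial_pow, one_pow]
  rw [imageExponent, Finsupp.linearCombination_apply, Finsupp.prod, Finsupp.sum,
    ← MvPolynomial.monomial_sum_one, MvPolynomial.algebraMap_eq, MvPolynomial.C_mul_monomial,
    mul_one]

/-- Monomials map to monomials with unchanged coefficients, so a term alone in its fibre could not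
cancel. -/
theorem exists_mem_support_imageExponent_eq (K : Type v) [Field K] {V : Type u} [Fintype V]
    {G : SimpleGraph V} {f : MvPolynomial (Cut V) K} (hf : f ∈ cutIdeal K G) {u : Cut V →₀ ℕ}
    (hu : u ∈ f.support) : ∃ v ∈ f.support, v ≠ u ∧ imageExponent G v = imageExponent G u := by
  classical
  by_contra! hcon
  have h0 : cutHom K G f = 0 := hf
  rw [← MvPolynomial.support_sum_monomial_coeff f, map_sum] at h0
  have := congrArg (MvPolynomial.coeff (imageExponent G u)) h0
  simp only [cutHom_monomial, MvPolynomial.coeff_sum, MvPolynomial.coeff_monomial,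
    MvPolynomial.coeff_zero] at this
  rw [Finset.sum_eq_single_of_mem u hu fun v hv hvu => if_neg (hcon v hv hvu), if_pos rfl] at this
  exact MvPolynomial.mem_support_iff.1 hu this

/-- No divisor of `u` of degree one or two can be replaced by a smaller monomial with the same
image under `cutHom`. -/
def IsStandard {V : Type u} [Fintype V] (G : SimpleGraph V) (m : MonomialOrder.{u, u} (Cut V))
    (u : Cut V →₀ ℕ) : Prop :=
  ∀ a b, a ≤ u → imageExponent G a = imageExponent G b → a.degree = 1 ∨ a.degree = 2 →
    m.toSyn a ≤ m.toSyn b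

/-- The binomials of degree one or two in the cut ideal. -/
def cutBinomials (K : Type v) [Field K] {V : Type u} [Fintype V] (G : SimpleGraph V) :
    Set (MvPolynomial (Cut V) K) :=
  {g | ∃ a b : Cut V →₀ ℕ, a ≠ b ∧ imageExponent G a = imageExponent G b ∧
    (a.degree = 1 ∨ a.degree = 2) ∧
    g = MvPolynomial.monomial a 1 - MvPolynomial.monomial b 1}

theorem cutBinomials_finite (K : Type v) [Field K] {V : Type u} [Fintype V] (G : SimpleGraph V) :
    (cutBinomials K G).Finite := by
  classical
  let T : Set (Cut V →₀ ℕ) := Set.Iic (Finsupp.equivFunOnFinite.symm fun _ => 2)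
  have hT : T.Finite := Set.finite_Iic _
  have hmem : ∀ a : Cut V →₀ ℕ, a.degree ≤ 2 → a ∈ T := fun a ha c =>
    (Finsupp.le_degree c a).trans ha
  refine ((hT.prod hT).image fun p : (Cut V →₀ ℕ) × (Cut V →₀ ℕ) =>
    MvPolynomial.monomial p.1 (1 : K) - MvPolynomial.monomial p.2 1).subset ?_
  rintro _ ⟨a, b, -, hab, hdeg, rfl⟩
  have := ((imageExponent_eq_iff G a b).1 hab).1
  exact ⟨(a, b), ⟨hmem a (by omega), hmem b (by omega)⟩, rfl⟩

theorem degree_monomial_sub (K : Type v) [Field K] {σ : Type u} (m : MonomialOrder.{u, u} σ)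
    {a b : σ →₀ ℕ} (h : m.toSyn b < m.toSyn a) :
    m.degree (MvPolynomial.monomial a (1 : K) - MvPolynomial.monomial b 1) = a := by
  classical
  have ha : m.degree (MvPolynomial.monomial a (1 : K)) = a := by simp [m.degree_monomial]
  have hb : m.degree (MvPolynomial.monomial b (1 : K)) = b := by simp [m.degree_monomial]
  rw [m.degree_sub_of_lt (by rwa [ha, hb]), ha]

theorem monomial_sub_ne_zero (K : Type v) [Field K] {σ : Type u} {a b : σ →₀ ℕ} (h : a ≠ b) :
    MvPolynomial.monomial a (1 : K) - MvPolynomial.monomial b 1 ≠ 0 := by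
  rw [sub_ne_zero]
  exact fun h' => h (MvPolynomial.monomial_left_injective one_ne_zero h')

/-- A leading monomial of the ideal shares its fibre with a smaller term. Since the least monomial
of the fibre is standard and standard monomials are unique there, the leading monomial is not
standard, so some binomial of degree one or two reduces it. -/
theorem isGroebnerBasis_cutBinomials (K : Type v) [Field K] {V : Type u} [Fintype V]
    (G : SimpleGraph V) (m : MonomialOrder.{u, u} (Cut V))
    (hstd : ∀ u v, imageExponent G u = imageExponent G v → IsStandard G m u → IsStandard G m v →
      u = v) :
    IsGroebnerBasis m (cutIdeal K G) (cutBinomials_finite K G).toFinset := by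
  have hmem : ∀ g ∈ cutBinomials K G, g ∈ cutIdeal K G ∧ g ≠ 0 := by
    rintro _ ⟨a, b, hne, hab, -, rfl⟩
    refine ⟨?_, monomial_sub_ne_zero K hne⟩
    change cutHom K G _ = 0
    rw [map_sub, cutHom_monomial, cutHom_monomial, hab, sub_self]
  refine ⟨fun g hg => hmem g ((cutBinomials_finite K G).mem_toFinset.1 hg), ?_⟩
  rw [Set.Finite.coe_toFinset]
  refine le_antisymm (Ideal.span_mono ?_) (Ideal.span_le.2 ?_)
  · rintro p ⟨g, hg, hp⟩
    exact ⟨g, (hmem g hg).1, hp⟩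
  · rintro _ ⟨f, hf, hf0, rfl⟩
    have hnot : ¬ IsStandard G m (m.degree f) := by
      intro hu
      obtain ⟨v, hv, hvu, hE⟩ := exists_mem_support_imageExponent_eq K hf (m.degree_mem_support hf0)
      have hlt : m.toSyn v < m.toSyn (m.degree f) :=
        lt_of_le_of_ne (m.le_degree hv) fun h => hvu (m.toSyn.injective h)
      obtain ⟨v', hv', hmin⟩ := WellFounded.has_min (InvImage.wf m.toSyn wellFounded_lt)
        {v' | imageExponent G v' = imageExponent G (m.degree f)} ⟨v, hE⟩
      have hv'std : IsStandard G m v' := by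
        intro a b hav hab _
        by_contra! hba
        obtain ⟨c, rfl⟩ := exists_add_of_le hav
        refine hmin (b + c) ?_ ?_
        · change imageExponent G (b + c) = _
          rw [map_add, ← hab, ← map_add]
          exact hv'
        · change m.toSyn (b + c) < m.toSyn (a + c)
          rw [map_add, map_add]
          exact add_lt_add_left hba _
      have := hstd _ _ hv' hv'std hu
      exact hmin v hE (this ▸ hlt)
    unfold IsStandard at hnot
    push Not at hnot
    obtain ⟨a, b, hau, hab, hdeg, hlt⟩ := hnot
    obtain ⟨c, hc⟩ := exists_add_of_le hau
    have : MvPolynomial.monomial (m.degree f) (1 : K) =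
        MvPolynomial.monomial c 1 * MvPolynomial.monomial a 1 := by
      rw [MvPolynomial.monomial_mul, hc, add_comm, one_mul]
    rw [this]
    refine Ideal.mul_mem_left _ _ (Ideal.subset_span ?_)
    have hne : a ≠ b := by rintro rfl; exact lt_irrefl _ hlt
    exact ⟨_, ⟨a, b, hne, hab, hdeg, rfl⟩, monomial_sub_ne_zero K hne,
      by rw [degree_monomial_sub K m hlt]⟩

/-! ### Transfer from cut vectors to monomials -/

theorem eq_of_isStandard {V : Type u} [Fintype V] [LinearOrder (Cut V)] (G : SimpleGraph V)
    {w : (Sym2 V → ℕ) → ℕ}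
    (hw : ∀ s t : Multiset (Sym2 V → ℕ), PairMinimal (cutVectors G) w s →
      PairMinimal (cutVectors G) w t → s.card = t.card → s.sum = t.sum → s = t)
    {u v : Cut V →₀ ℕ} (huv : imageExponent G u = imageExponent G v)
    (hu : IsStandard G (weightLex fun c => w (cutVec G c)) u)
    (hv : IsStandard G (weightLex fun c => w (cutVec G c)) v) : u = v := by
  classical
  set m := weightLex fun c => w (cutVec G c) with hm
  have le_one : ∀ c e, cutVec G c e ≤ 1 := by
    intro c e
    unfold cutVec; split_ifs <;> omega
  have single_le : ∀ (u : Cut V →₀ ℕ) (c), c ∈ Finsupp.toMultiset u → Finsupp.single c 1 ≤ u := by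
    intro u c hc
    rw [Finsupp.mem_toMultiset, Finsupp.mem_support_iff] at hc
    rw [Finsupp.single_le_iff]
    omega
  -- In a disconnected graph different cuts may separate the same edges. The linear binomials leave
  -- only the least such cut.
  have inj : ∀ u v, IsStandard G m u → IsStandard G m v → ∀ c ∈ Finsupp.toMultiset u,
      ∀ d ∈ Finsupp.toMultiset v, cutVec G c = cutVec G d → c = d := by
    intro u v hu hv c hc d hd hcd
    have hE : imageExponent G (Finsupp.single c 1) = imageExponent G (Finsupp.single d 1) :=
      (imageExponent_eq_iff _ _ _).2 (by simp [hcd])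
    have h1 := hu _ _ (single_le u c hc) hE (by simp)
    have h2 := hv _ _ (single_le v d hd) hE.symm (by simp)
    exact Finsupp.single_left_injective one_ne_zero (m.toSyn.injective (le_antisymm h1 h2))
  have pm : ∀ u, IsStandard G m u →
      PairMinimal (cutVectors G) w ((Finsupp.toMultiset u).map (cutVec G)) := by
    intro u hu
    refine ⟨fun x hx => ?_, ?_⟩
    · obtain ⟨c, -, rfl⟩ := Multiset.mem_map.1 hx
      exact ⟨c, rfl⟩
    · rintro x hx y hy _ ⟨c', rfl⟩ _ ⟨d', rfl⟩ h
      obtain ⟨c, hc, rfl⟩ := Multiset.mem_map.1 hx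
      obtain ⟨d, hd, rfl⟩ := Multiset.mem_map.1 hy
      -- Pairwise minimality also tests an element against itself, even when it occurs only once.
      -- Such a test is harmless: a 0/1 vector doubled is a sum of two 0/1 vectors in only one way.
      by_cases hcd : c = d
      · subst hcd
        have h1 : cutVec G c' = cutVec G c := by
          funext e
          have := congrFun h e
          have e1 := le_one c e
          have e2 := le_one c' e
          have e3 := le_one d' e
          simp only [Pi.add_apply] at this
          omega
        have h2 : cutVec G d' = cutVec G c := by
          rw [h1] at h
          exact (add_left_cancel h).symm
        rw [h1, h2]
      · have hle : Finsupp.single c 1 + Finsupp.single d 1 ≤ u := by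
          intro x
          have h1 := single_le u c hc x
          have h2 := single_le u d hd x
          simp only [Finsupp.add_apply, Finsupp.single_apply] at *
          split_ifs at * <;> first | omega | (exfalso; apply hcd; simp_all)
        have := hu (Finsupp.single c 1 + Finsupp.single d 1)
          (Finsupp.single c' 1 + Finsupp.single d' 1) hle
          ((imageExponent_eq_iff _ _ _).2 (by simpa using h)) (by simp)
        by_contra! hlt
        refine absurd this (not_le.2 (weightLex_lt_of_weight_lt ?_))
        simpa [Finsupp.weight_single] using hlt
  obtain ⟨h1, h2⟩ := (imageExponent_eq_iff G u v).1 huv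
  have hmap := hw _ _ (pm u hu) (pm v hv) (by
    simp only [Multiset.card_map, Finsupp.card_toMultiset]
    exact h1) h2
  refine (Finsupp.orderIsoMultiset (ι := Cut V)).injective ?_
  simp only [Finsupp.coe_orderIsoMultiset]
  let A : Set (Cut V) := {c | c ∈ Finsupp.toMultiset u ∨ c ∈ Finsupp.toMultiset v}
  have hinj : Set.InjOn (cutVec G) A := by
    rintro c (hc | hc) d (hd | hd) h
    · exact inj u u hu hu c hc d hd h
    · exact inj u v hu hv c hc d hd h
    · exact inj v u hv hu c hc d hd h
    · exact inj v v hv hv c hc d hd h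
  have : Nonempty (Cut V) := ⟨Cut.mk ∅⟩
  have hinv : ∀ s : Multiset (Cut V), (∀ c ∈ s, c ∈ A) →
      (s.map (cutVec G)).map (Function.invFunOn (cutVec G) A) = s := by
    intro s hs
    rw [Multiset.map_map]
    conv_rhs => rw [← Multiset.map_id s]
    exact Multiset.map_congr rfl fun c hc => hinj.leftInvOn_invFunOn (hs c hc)
  rw [← hinv _ fun c hc => Or.inl hc, hmap, hinv _ fun c hc => Or.inr hc]

/-- Starting from the side of one vertex, the separated edges fix the side of every vertex along
walks. Hence there are no linear binomials when `G` is connected. -/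
theorem cutVec_injective_of_connected {V : Type u} {G : SimpleGraph V} (hG : G.Connected) :
    Function.Injective (cutVec G) := by
  classical
  intro c d h
  obtain ⟨z⟩ := hG.nonempty
  obtain ⟨A, hA, rfl⟩ := c.exists_mk_notMem z
  obtain ⟨B, hB, rfl⟩ := d.exists_mk_notMem z
  have hadj : ∀ x y, G.Adj x y → (x ∈ A ↔ x ∈ B) → (y ∈ A ↔ y ∈ B) := by
    intro x y hxy hx
    have := congrFun h s(x, y)
    rw [cutVec_mk, cutVec_mk] at this
    by_cases h1 : x ∈ A ↔ y ∈ A <;> by_cases h2 : x ∈ B ↔ y ∈ B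
    · tauto
    · simp [hxy, h1, h2] at this
    · simp [hxy, h1, h2] at this
    · tauto
  have hwalk : ∀ x y (_ : G.Walk x y), (x ∈ A ↔ x ∈ B) → (y ∈ A ↔ y ∈ B) := by
    intro x y p
    induction p with
    | nil => exact id
    | cons h p ih => exact fun hx => ih (hadj _ _ h hx)
  congr 1
  ext y
  obtain ⟨p⟩ := hG.preconnected z y
  exact hwalk z y p (by simp [hA, hB])

end CutIdeal

theorem mainTheorem3 (K : Type v) [Field K] {V : Type u} [Fintype V] (G : SimpleGraph V)
    (hK4 : ¬ CutIdeal.HasMinor G (SimpleGraph.completeGraph (Fin 4)))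
    (hC5 : ¬ CutIdeal.HasMinor G (SimpleGraph.cycleGraph 5)) :
    ∃ (m : MonomialOrder.{u, u} (CutIdeal.Cut V))
      (S : Finset (MvPolynomial (CutIdeal.Cut V) K)),
      CutIdeal.IsGroebnerBasis m (CutIdeal.cutIdeal K G) S ∧
      (∀ g ∈ S, g.IsHomogeneous 1 ∨ g.IsHomogeneous 2) ∧
      (G.Connected → ∀ g ∈ S, g.IsHomogeneous 2) := by
  classical
  obtain ⟨w, hw⟩ := CutIdeal.quadraticallyDetermined_of_minorFree G hK4 hC5
  let _ : LinearOrder (CutIdeal.Cut V) := linearOrderOfSTO WellOrderingRel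
  have hom : ∀ (a b : CutIdeal.Cut V →₀ ℕ) (n : ℕ), a.degree = n →
      CutIdeal.imageExponent G a = CutIdeal.imageExponent G b →
      (MvPolynomial.monomial a (1 : K) - MvPolynomial.monomial b 1).IsHomogeneous n := by
    intro a b n ha hab
    refine MvPolynomial.IsHomogeneous.sub (MvPolynomial.isHomogeneous_monomial _ ha)
      (MvPolynomial.isHomogeneous_monomial _ ?_)
    rw [← ((CutIdeal.imageExponent_eq_iff G a b).1 hab).1, ha]
  refine ⟨CutIdeal.weightLex fun c => w (CutIdeal.cutVec G c),
    (CutIdeal.cutBinomials_finite K G).toFinset,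
    CutIdeal.isGroebnerBasis_cutBinomials K G _ fun u v huv hu hv =>
      CutIdeal.eq_of_isStandard G hw huv hu hv, ?_, ?_⟩
  · intro g hg
    obtain ⟨a, b, -, hab, hdeg, rfl⟩ := (CutIdeal.cutBinomials_finite K G).mem_toFinset.1 hg
    exact hdeg.imp (fun h => hom a b 1 h hab) (fun h => hom a b 2 h hab)
  · intro hG g hg
    obtain ⟨a, b, hne, hab, hdeg, rfl⟩ := (CutIdeal.cutBinomials_finite K G).mem_toFinset.1 hg
    refine hom a b 2 (hdeg.resolve_left fun h1 => hne ?_) hab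
    obtain ⟨hd, hs⟩ := (CutIdeal.imageExponent_eq_iff G a b).1 hab
    obtain ⟨c, rfl⟩ := (Finsupp.sum_eq_one_iff a).1 h1
    obtain ⟨d, rfl⟩ := (Finsupp.sum_eq_one_iff b).1 (hd.symm.trans h1)
    rw [CutIdeal.cutVec_injective_of_connected hG (a₁ := c) (a₂ := d) (by simpa using hs)]
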